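/- **Proposition 5.3** ($\varphi(3)\ge\mu(P)$). Let $k$ be a field. For a finite set $B\subseteq\mathbb{Z}^m$ let $J_B\subseteq k[x_b : b\in B]$ be the lattice ideal generated by the binomials $$\prod_{b\in B:\,u\cdot b>0}x_b^{\,u\cdot b}\;-\prod_{b\in B:\,u\cdot b<0}x_b^{-u\cdot b},\qquad u\in\mathbb{Z}^m .$$ Let $\mathrm{cone}(B)\subseteq\mathbb{R}^m$ be the cone spanned by $B$. For $w\in\mathrm{cone}(B)$ let $in_w(J_B)$ be the ideal generated by the monomials $\prod_{u\cdot b>0}x_b^{\,u\cdot b}$ for $u\in\mathbb{Z}^m$ with $u\cdot w>0$, together with the above binomials for $u\in\mathbb{Z}^m$ with $u\cdot w=0$. Two vectors $w,w'\in\mathrm{cone}(B)$ lie in the same cell of the Gröbner fan of $J_B$ if $in_w(J_B)=in_{w'}(J_B)$; the cones of the Gröbner fan are the closures of its cells. Let $\varphi(m)\in\mathbb{N}\cup\{\infty\}$ be the supremum of the number of facets of a cone in the Gröbner fan of $J_B$, over all finite $B\subseteq\mathbb{Z}^m$ for which $J_B$ has codimension $m$ and over all cones of that fan. Let $P\subseteq\mathbb{R}^2$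 be a lattice polygon, that is, a two-dimensional convex hull of finitely many points of $\mathbb{Z}^2$. The chamber complex of $P$ is the common refinement of all lattice triangulations of $P$ (triangulations of $P$ with all vertices in $\mathbb{Z}^2$), and its regions are its two-dimensional cells. Let $\mu(P)$ be the maximum number of edges of a region of the chamber complex of $P$. Then every lattice polygon $P$ satisfies $$\varphi(3)\;\ge\;\mu(P).$$ -/

import Mathlib

namespace Supernormal

/-- The coordinatewise embedding of `ℤ^m` into `ℝ^m`. -/
def toReal {m : ℕ} (u : Fin m → ℤ) : Fin m → ℝ := fun i => (u i : ℝ)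

/-! ### Facets -/

/-- The facets of a polyhedron `C`: its nonempty (exposed) faces of dimension `dim C - 1`. For a
convex polygon in the plane these are its edges. -/
def facets {E : Type*} [AddCommGroup E] [Module ℝ E] [TopologicalSpace E] (C : Set E) :
    Set (Set E) :=
  {F | F.Nonempty ∧ IsExposed ℝ C F ∧
    Module.finrank ℝ (vectorSpan ℝ F) + 1 = Module.finrank ℝ (vectorSpan ℝ C)}

/-! ### The ideal of a vector configuration and its Gröbner fan

A configuration is a finite subset `B` of `ℤ^m`; the polynomial ring has one variable for each
element of `B`. -/

section Algebra

variable (k : Type*) [Field k] {m : ℕ} (B : Finset (Fin m → ℤ))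

/-- The monomial `∏_{b ∈ B, u · b > 0} x_b ^ (u · b)`. -/
noncomputable def posMonomial (u : Fin m → ℤ) : MvPolynomial B k :=
  ∏ b : B, MvPolynomial.X b ^ (u ⬝ᵥ b.1).toNat

/-- The binomial `∏_{u · b > 0} x_b ^ (u · b) - ∏_{u · b < 0} x_b ^ (- u · b)`. -/
noncomputable def binomial (u : Fin m → ℤ) : MvPolynomial B k :=
  posMonomial k B u - posMonomial k B (-u)

/-- The ideal `J_B`: the lattice ideal of the lattice spanned by the rows of the matrix whose
columns are the elements of `B`. -/
noncomputable def latticeIdeal : Ideal (MvPolynomial B k) :=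
  Ideal.span (Set.range (binomial k B))

/-- The initial ideal `in_w(J_B)`. -/
noncomputable def initialIdeal (w : Fin m → ℝ) : Ideal (MvPolynomial B k) :=
  Ideal.span (posMonomial k B '' {u | 0 < toReal u ⬝ᵥ w} ∪
    binomial k B '' {u | toReal u ⬝ᵥ w = 0})

/-- The polyhedral cone in `ℝ^m` spanned by `B`. -/
def cone : Set (Fin m → ℝ) :=
  (PointedCone.hull ℝ (toReal '' (B : Set (Fin m → ℤ))) : Set (Fin m → ℝ))

/-- The cell of the Gröbner fan of `J_B` that contains `w` (a relatively open cone). -/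
def groebnerCell (w : Fin m → ℝ) : Set (Fin m → ℝ) :=
  {w' | w' ∈ cone B ∧ initialIdeal k B w' = initialIdeal k B w}

/-- `C` is a (closed) cone of the Gröbner fan of `J_B`. -/
def IsGroebnerCone (C : Set (Fin m → ℝ)) : Prop :=
  ∃ w ∈ cone B, C = closure (groebnerCell k B w)

end Algebra

/-- `φ(m)`: the maximal number of facets (a supremum in `ℕ∞`) of a cone in the Gröbner fan of an
ideal `J_B`, `B ⊆ ℤ^m`, of codimension `m`. -/
noncomputable def phi (k : Type*) [Field k] (m : ℕ) : ℕ∞ :=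
  ⨆ (B : Finset (Fin m → ℤ)) (_ : (latticeIdeal k B).height = m)
    (C : Set (Fin m → ℝ)) (_ : IsGroebnerCone k B C), (facets C).encard

/-! ### The chamber complex of a lattice polygon -/

/-- A (two-dimensional, convex) lattice polygon. -/
def IsLatticePolygon (P : Set (Fin 2 → ℝ)) : Prop :=
  (∃ V : Finset (Fin 2 → ℤ), P = convexHull ℝ (toReal '' (V : Set (Fin 2 → ℤ)))) ∧
    (interior P).Nonempty

/-- `K` is a lattice triangulation of `P`: a triangulation of `P` all of whose vertices are lattice
points (not every lattice point of `P` has to be a vertex). -/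
def IsLatticeTriangulation (P : Set (Fin 2 → ℝ))
    (K : Geometry.SimplicialComplex ℝ (Fin 2 → ℝ)) : Prop :=
  K.space = P ∧ K.vertices ⊆ Set.range toReal

/-- `R` is a region of the chamber complex of `P`, that is, a two-dimensional cell of the common
refinement of all lattice triangulations of `P`. The cells of the common refinement are the
intersections of `P` with one face from each of the triangulations. -/
def IsRegion (P R : Set (Fin 2 → ℝ)) : Prop :=
  (interior R).Nonempty ∧
    ∃ σ : Geometry.SimplicialComplex ℝ (Fin 2 → ℝ) → Finset (Fin 2 → ℝ),
      (∀ K, IsLatticeTriangulation P K → σ K ∈ K.faces) ∧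
      R = P ∩ ⋂ (K) (_ : IsLatticeTriangulation P K), convexHull ℝ (σ K : Set (Fin 2 → ℝ))

/-- `μ(P)`: the maximal number of edges of a region in the chamber complex of `P`. -/
noncomputable def mu (P : Set (Fin 2 → ℝ)) : ℕ∞ :=
  ⨆ (R : Set (Fin 2 → ℝ)) (_ : IsRegion P R), (facets R).encard

end Supernormal

namespace Supernormal

/-! ### Affine bases of the plane and the exchange step -/

/-! Let `A` be the set of all lattice points of `P` and `B` the set of vectors `(a, 1)`, `a ∈ A`. At
height one the full-dimensional cells of the Gröbner fan of `J_B` are the regions of the chamber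
complex: for `r` in the interior of a region `R`, the closure of the cell of `lift r` is the cone
over `R` (`IsRegion.closure_groebnerCell`), and distinct edges of `R` span distinct facets of that
cone.

Every lattice triangle belongs to some lattice triangulation (`exists_triangulation`), so a region
is the intersection of the triangles on `A` that contain it, and its interior avoids all segments
between points of `A`.

The initial ideal is constant on the interior of `R`. For `u ≠ 0` with `u · (r, 1) ≥ 0`, the linear
program of maximising `v · (r', 1)` subject to `v · (a, 1) ≤ max (u · (a, 1)) 0` on `A` has an
integral optimum, because the contact set of an optimal real solution contains an empty, hence
unimodular, triangle around `r'` (`exists_integral_minorant`). The optimum is positive, since value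
zero would put `r'`, and so `r`, into the hull of the points where `u` is nonpositive. The monomial
of `v` divides that of `u`. Conversely, a point outside `R` is cut off by an edge of a triangle that
contains `R`; the normal of that edge gives a monomial in its initial ideal that is standard at `r`
(`posMonomial_notMem_initialIdeal`).

The codimension is 3 because a unimodular triangle at height one is a basis of `ℤ^3`
(`height_latticeIdeal`). -/

theorem coord_eq_of_sum {ι V : Type*} [Fintype ι] [AddCommGroup V] [Module ℝ V]
    (p : AffineBasis ι ℝ V) {w : ι → ℝ} {x : V} (hw : ∑ i, w i = 1) (hx : ∑ i, w i • p i = x)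
    (j : ι) : p.coord j x = w j := by
  rw [← hx, ← Finset.univ.affineCombination_eq_linear_combination p w hw]
  exact p.coord_apply_combination_of_mem (Finset.mem_univ j) hw

/-- The affine function that agrees with `c` on the affine basis `p`. -/
noncomputable def interp {ι V : Type*} [Fintype ι] [AddCommGroup V] [Module ℝ V]
    (p : AffineBasis ι ℝ V) (c : V → ℝ) : V →ᵃ[ℝ] ℝ := ∑ i, c (p i) • p.coord i

theorem interp_apply {ι V : Type*} [Fintype ι] [AddCommGroup V] [Module ℝ V]
    (p : AffineBasis ι ℝ V) (c : V → ℝ) (x : V) :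
    interp p c x = ∑ i, p.coord i x * c (p i) := by
  simp only [interp]
  have : ∀ s : Finset ι, (∑ i ∈ s, c (p i) • p.coord i : V →ᵃ[ℝ] ℝ) x =
      ∑ i ∈ s, p.coord i x * c (p i) := by
    intro s
    classical
    induction s using Finset.induction_on with
    | empty => simp
    | insert a s ha ih => rw [Finset.sum_insert ha, Finset.sum_insert ha, AffineMap.coe_add,
        Pi.add_apply, ih]; simp [mul_comm]
  exact this _

theorem interp_basis {ι V : Type*} [Fintype ι] [AddCommGroup V] [Module ℝ V]
    (p : AffineBasis ι ℝ V) (c : V → ℝ) (i : ι) : interp p c (p i) = c (p i) := by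
  classical
  rw [interp_apply]
  simp [AffineBasis.coord_apply]

theorem affineMap_apply_eq_sum {ι V : Type*} [Fintype ι] [AddCommGroup V] [Module ℝ V]
    (p : AffineBasis ι ℝ V) (f : V →ᵃ[ℝ] ℝ) (x : V) : f x = ∑ i, p.coord i x * f (p i) := by
  conv_lhs => rw [← p.affineCombination_coord_eq_self x]
  rw [Finset.map_affineCombination _ _ _ (p.sum_coord_apply_eq_one x),
    Finset.affineCombination_eq_linear_combination _ _ _ (p.sum_coord_apply_eq_one x)]
  simp

/-- A simplex pivot: `d` replaces vertex `i`. Eliminating `p i` through the expansion of `d` gives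
`x` the coordinate `p.coord i x / p.coord i d` at `d`; for `j = i` the first two terms of the
formula cancel. -/
theorem exists_exchange {ι V : Type*} [Fintype ι] [DecidableEq ι] [AddCommGroup V] [Module ℝ V]
    [FiniteDimensional ℝ V]
    (p : AffineBasis ι ℝ V) (i : ι) (d : V) (hd : p.coord i d ≠ 0) :
    ∃ q : AffineBasis ι ℝ V, (∀ j, q j = if j = i then d else p j) ∧
      ∀ x j, q.coord j x = p.coord j x - p.coord i x / p.coord i d * p.coord j d +
        if j = i then p.coord i x / p.coord i d else 0 := by
  have hind : AffineIndependent ℝ (Function.update p i d) := by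
    apply p.ind.affineIndependent_update_of_notMem_affineSpan
    intro hmem
    apply hd
    have hle : affineSpan ℝ (p '' {x | x ≠ i}) ≤
        (AffineSubspace.mk' (0 : ℝ) ⊥).comap (p.coord i) := by
      rw [affineSpan_le]
      rintro _ ⟨j, hj, rfl⟩
      simp [AffineBasis.coord_apply_ne _ (Ne.symm hj), AffineSubspace.mem_mk']
    have := hle hmem
    simpa [AffineSubspace.mem_mk'] using this
  have hcard : Fintype.card ι = Module.finrank ℝ V + 1 :=
    (p.ind.affineSpan_eq_top_iff_card_eq_finrank_add_one).1 p.tot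
  let q : AffineBasis ι ℝ V := ⟨Function.update p i d, hind,
    (hind.affineSpan_eq_top_iff_card_eq_finrank_add_one).2 hcard⟩
  have hq : ∀ j, q j = if j = i then d else p j := by
    intro j
    show Function.update p i d j = _
    rw [Function.update_apply]
  refine ⟨q, hq, fun x => coord_eq_of_sum q ?_ ?_⟩
  · rw [Finset.sum_add_distrib, Finset.sum_sub_distrib, ← Finset.mul_sum,
      p.sum_coord_apply_eq_one, p.sum_coord_apply_eq_one]
    simp
  · have h1 : ∀ j, (p.coord j x - p.coord i x / p.coord i d * p.coord j d +
        if j = i then p.coord i x / p.coord i d else 0) • q j =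
        p.coord j x • p j - (p.coord i x / p.coord i d) • (p.coord j d • p j) +
        if j = i then (p.coord i x / p.coord i d) • d else 0 := by
      intro j
      rw [hq]
      split_ifs with h
      · subst h
        rw [smul_smul, ← sub_smul, div_mul_cancel₀ _ hd]
        simp
      · rw [smul_smul, ← sub_smul]; simp
    rw [Finset.sum_congr rfl fun j _ => h1 j, Finset.sum_add_distrib, Finset.sum_sub_distrib,
      ← Finset.smul_sum, p.linear_combination_coord_eq_self, p.linear_combination_coord_eq_self]
    simp

/-- `x` lies on no segment between two points of `A`. -/
def Generic (A : Finset (Fin 2 → ℝ)) (x : Fin 2 → ℝ) : Prop :=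
  ∀ a ∈ A, ∀ b ∈ A, x ∉ segment ℝ a b

theorem Generic.mono {A D : Finset (Fin 2 → ℝ)} {x : Fin 2 → ℝ} (h : Generic A x) (hD : D ⊆ A) :
    Generic D x := fun a ha b hb => h a (hD ha) b (hD hb)

/-- A vanishing coordinate would place `x` on the segment between the other two vertices. Pivots at
a generic point are therefore nondegenerate. -/
theorem Generic.coord_ne_zero {A : Finset (Fin 2 → ℝ)} {x : Fin 2 → ℝ} (h : Generic A x)
    (p : AffineBasis (Fin 3) ℝ (Fin 2 → ℝ)) (hp : ∀ i, p i ∈ A) (h0 : ∀ i, 0 ≤ p.coord i x)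
    (i : Fin 3) : 0 < p.coord i x := by
  refine lt_of_le_of_ne (h0 i) fun hi => ?_
  have h1 := p.sum_coord_apply_eq_one x
  have h2 := p.linear_combination_coord_eq_self x
  rw [Fin.sum_univ_three] at h1 h2
  have hi' : p.coord i x = 0 := hi.symm
  clear hi
  fin_cases i
  · change p.coord 0 x = 0 at hi'
    rw [hi'] at h1 h2
    exact h _ (hp 1) _ (hp 2) ⟨_, _, h0 1, h0 2, by simpa using h1, by simpa using h2⟩
  · change p.coord 1 x = 0 at hi'
    rw [hi'] at h1 h2
    exact h _ (hp 0) _ (hp 2) ⟨_, _, h0 0, h0 2, by simpa using h1, by simpa using h2⟩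
  · change p.coord 2 x = 0 at hi'
    rw [hi'] at h1 h2
    exact h _ (hp 0) _ (hp 1) ⟨_, _, h0 0, h0 1, by simpa using h1, by simpa using h2⟩

/-- By Carathéodory, `x` is a positive combination of affinely independent points; fewer than three
would put it on a possibly degenerate segment. -/
theorem Generic.exists_basis {A : Finset (Fin 2 → ℝ)} {x : Fin 2 → ℝ} (h : Generic A x)
    (hx : x ∈ convexHull ℝ (A : Set (Fin 2 → ℝ))) :
    ∃ p : AffineBasis (Fin 3) ℝ (Fin 2 → ℝ), (∀ i, p i ∈ A) ∧ ∀ i, 0 < p.coord i x := by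
  obtain ⟨ι, hι, z, w, hz, hind, hw0, hw1, hwx⟩ := eq_pos_convex_span_of_mem_convexHull hx
  have hz' : ∀ i, z i ∈ A := fun i => by simpa using hz (Set.mem_range_self i)
  have hle : Fintype.card ι ≤ 3 := by
    have := hind.card_le_finrank_succ
    have h2 := Submodule.finrank_le (vectorSpan ℝ (Set.range z))
    simp at h2
    omega
  have hcard : Fintype.card ι = 3 := by
    have key : ∀ n, Fintype.card ι = n → n ≤ 2 → False := by
      intro n hn hn2
      have e := Fintype.equivFinOfCardEq hn
      rw [← e.symm.sum_comp] at hw1 hwx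
      interval_cases n
      · simp at hw1
      · simp at hw1 hwx
        exact h _ (hz' (e.symm 0)) _ (hz' (e.symm 0)) (by rw [← hwx, hw1]; simp [segment_same])
      · rw [Fin.sum_univ_two] at hw1 hwx
        exact h _ (hz' _) _ (hz' _) ⟨_, _, (hw0 _).le, (hw0 _).le, hw1, hwx⟩
    by_contra hne
    exact key _ rfl (by omega)
  have e := Fintype.equivFinOfCardEq hcard
  let p0 : AffineBasis ι ℝ (Fin 2 → ℝ) := ⟨z, hind,
    (hind.affineSpan_eq_top_iff_card_eq_finrank_add_one).2 (by simp [hcard])⟩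
  refine ⟨p0.reindex e, fun i => hz' (e.symm i), fun i => ?_⟩
  rw [AffineBasis.coord_reindex, coord_eq_of_sum p0 hw1 hwx]
  exact hw0 _

/-- Linear programming duality at a generic point: the value at `x` of some lower affine support
function of `c` on `A` is attained on a triangle that contains `x`. -/
theorem Generic.exists_interp_le {A : Finset (Fin 2 → ℝ)} {x : Fin 2 → ℝ} (h : Generic A x)
    (hx : x ∈ convexHull ℝ (A : Set (Fin 2 → ℝ))) (c : (Fin 2 → ℝ) → ℝ) :
    ∃ p : AffineBasis (Fin 3) ℝ (Fin 2 → ℝ), (∀ i, p i ∈ A) ∧ (∀ i, 0 < p.coord i x) ∧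
      ∀ a ∈ A, interp p c a ≤ c a := by
  let S : Set (AffineBasis (Fin 3) ℝ (Fin 2 → ℝ)) :=
    {p | (∀ i, p i ∈ A) ∧ ∀ i, 0 < p.coord i x}
  have hfin : S.Finite := by
    have : (Set.pi Set.univ fun _ : Fin 3 => (A : Set (Fin 2 → ℝ))).Finite :=
      Set.Finite.pi fun _ => A.finite_toSet
    refine Set.Finite.of_finite_image (f := fun p => (p : Fin 3 → Fin 2 → ℝ)) (this.subset ?_) ?_
    · rintro _ ⟨p, hp, rfl⟩ i -
      exact hp.1 i
    · intro p _ q _ hpq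
      exact AffineBasis.ext hpq
  -- Finitely many triangles on `A` contain `x`. On the one with the lowest interpolated value at
  -- `x`, a point `d` below the interpolant would allow a pivot that lowers the value.
  obtain ⟨p, hpS, hmin⟩ := Set.exists_min_image S (fun p => interp p c x) hfin (h.exists_basis hx)
  refine ⟨p, hpS.1, hpS.2, fun d hd => ?_⟩
  by_contra! hlt
  -- The ratio test: the vertex of least ratio leaves, so that all new coordinates of `x` stay
  -- nonnegative.
  obtain ⟨i, hi, himin⟩ : ∃ i, 0 < p.coord i d ∧ ∀ j, 0 < p.coord j d →
      p.coord i x / p.coord i d ≤ p.coord j x / p.coord j d := by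
    have hne : (Finset.univ.filter fun i => 0 < p.coord i d).Nonempty := by
      by_contra hne
      rw [Finset.not_nonempty_iff_eq_empty, Finset.filter_eq_empty_iff] at hne
      have := p.sum_coord_apply_eq_one d
      have h2 : ∑ i, p.coord i d ≤ 0 :=
        Finset.sum_nonpos fun i _ => not_lt.1 (hne (Finset.mem_univ i))
      linarith
    obtain ⟨i, hi, h2⟩ := Finset.exists_min_image _ (fun i => p.coord i x / p.coord i d) hne
    exact ⟨i, (Finset.mem_filter.1 hi).2, fun j hj => h2 j (by simp [hj])⟩
  obtain ⟨q, hq, hqc⟩ := exists_exchange p i d hi.ne'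
  set t := p.coord i x / p.coord i d with ht
  have ht0 : 0 < t := div_pos (hpS.2 i) hi
  have hqA : ∀ j, q j ∈ A := by
    intro j
    rw [hq]
    split_ifs
    exacts [hd, hpS.1 j]
  have hq0 : ∀ j, 0 ≤ q.coord j x := by
    intro j
    rw [hqc]
    have : 0 ≤ p.coord j x - t * p.coord j d := by
      rcases lt_or_ge 0 (p.coord j d) with hj | hj
      · have := himin j hj
        rw [le_div_iff₀ hj] at this
        linarith
      · have := hpS.2 j
        nlinarith
    split_ifs
    · linarith
    · linarith
  have hqS : q ∈ S := ⟨hqA, h.coord_ne_zero q hqA hq0⟩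
  have hval : interp q c x = interp p c x + t * (c d - interp p c d) := by
    have h1 : ∀ j, q.coord j x * c (q j) = p.coord j x * c (p j) - t * (p.coord j d * c (p j)) +
        if j = i then t * c d else 0 := by
      intro j
      rw [hqc, hq]
      split_ifs with hj
      · subst hj
        rw [ht]
        field_simp
        ring
      · ring
    rw [interp_apply, interp_apply, interp_apply, Finset.sum_congr rfl fun j _ => h1 j,
      Finset.sum_add_distrib, Finset.sum_sub_distrib, ← Finset.mul_sum]
    simp
    ring
  have := hmin q hqS
  simp only [hval] at this
  nlinarith

/-! ### Every lattice triangle belongs to a triangulation -/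

theorem sum_mul_affineMap {V : Type*} [AddCommGroup V] [Module ℝ V] (s : Finset V)
    (w : V → ℝ) (f : V →ᵃ[ℝ] ℝ) :
    ∑ a ∈ s, w a * f a = f.linear (∑ a ∈ s, w a • a) + (∑ a ∈ s, w a) * f 0 := by
  have h2 : ∀ a, w a * f a = w a * f.linear a + w a * f 0 := fun a => by
    rw [← mul_add]
    exact congrArg _ (congrFun f.decomp a)
  rw [Finset.sum_congr rfl fun a _ => h2 a, Finset.sum_add_distrib, Finset.sum_mul, map_sum]
  simp

theorem sum_mul_affineMap_eq_zero {V : Type*} [AddCommGroup V] [Module ℝ V] {s : Finset V}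
    {w : V → ℝ} (h0 : ∑ a ∈ s, w a • a = 0) (h1 : ∑ a ∈ s, w a = 0) (f : V →ᵃ[ℝ] ℝ) :
    ∑ a ∈ s, w a * f a = 0 := by
  rw [sum_mul_affineMap, h0, h1]
  simp

theorem sum_mul_affineMap_eq {V : Type*} [AddCommGroup V] [Module ℝ V] {s : Finset V}
    {w : V → ℝ} {x : V} (h0 : ∑ a ∈ s, w a • a = x) (h1 : ∑ a ∈ s, w a = 1) (f : V →ᵃ[ℝ] ℝ) :
    ∑ a ∈ s, w a * f a = f x := by
  rw [sum_mul_affineMap, h0, h1, one_mul]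
  exact (congrFun f.decomp x).symm

/-- Heights that vanish on a given triangle and are so generic that they agree with an affine
function only on affinely independent sets. -/
theorem exists_generic_height (A : Finset (Fin 2 → ℝ)) (p : AffineBasis (Fin 3) ℝ (Fin 2 → ℝ)) :
    ∃ ω : (Fin 2 → ℝ) → ℝ, (∀ i, ω (p i) = 0) ∧ (∀ a, 0 ≤ ω a) ∧
      ∀ s ⊆ A, ∀ f : (Fin 2 → ℝ) →ᵃ[ℝ] ℝ, (∀ a ∈ s, f a = ω a) →
        AffineIndependent ℝ ((↑) : s → Fin 2 → ℝ) := by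
  classical
  let idx : (Fin 2 → ℝ) → ℕ := fun a => if h : a ∈ A then (A.equivFin ⟨a, h⟩ : ℕ) else 0
  have hidx : ∀ a ∈ A, ∀ b ∈ A, idx a = idx b → a = b := by
    intro a ha b hb hab
    simp only [idx, ha, hb, dif_pos] at hab
    simpa using A.equivFin.injective (Fin.ext hab)
  have hrel : ∀ s : Finset (Fin 2 → ℝ), ∃ w : (Fin 2 → ℝ) → ℝ,
      ¬ AffineIndependent ℝ ((↑) : s → Fin 2 → ℝ) →
      (∑ e ∈ s, w e • e = 0 ∧ ∑ e ∈ s, w e = 0 ∧ ∃ x ∈ s, w x ≠ 0) := by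
    intro s
    by_cases h : AffineIndependent ℝ ((↑) : s → Fin 2 → ℝ)
    · exact ⟨0, fun h' => absurd h h'⟩
    · obtain ⟨w, hw⟩ := exists_nontrivial_relation_sum_zero_of_not_affine_ind h
      exact ⟨w, fun _ => hw⟩
  choose w hw using hrel
  -- The height off the triangle will be `t ^ idx a`. If an affine function agrees with the heights
  -- on a dependent set `s`, the chosen relation on `s` makes `t` a root of `Q s`.
  let Q : Finset (Fin 2 → ℝ) → Polynomial ℝ := fun s =>
    ∑ a ∈ s with a ∉ Set.range p, Polynomial.C (w s a) * Polynomial.X ^ idx a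
  let bad : Finset (Finset (Fin 2 → ℝ)) := A.powerset.filter fun s => ¬ AffineIndependent ℝ ((↑) : s → Fin 2 → ℝ)
  -- The exponents are distinct on `A`, so `Q s = 0` confines the relation to the vertices of `p`,
  -- where the barycentric coordinates force it to be trivial.
  have hQ : ∀ s ∈ bad, Q s ≠ 0 := by
    intro s hs h0
    obtain ⟨hsA, hs⟩ := Finset.mem_filter.1 hs
    rw [Finset.mem_powerset] at hsA
    obtain ⟨h1, h2, x, hx, hwx⟩ := hw s hs
    have hoff : ∀ a ∈ s, a ∉ Set.range p → w s a = 0 := by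
      intro a ha hap
      have h3 := congrArg (fun q => Polynomial.coeff q (idx a)) h0
      simp only [Q, Polynomial.finsetSum_coeff, Polynomial.coeff_C_mul_X_pow,
        Polynomial.coeff_zero] at h3
      rw [Finset.sum_eq_single a] at h3
      · simpa using h3
      · intro b hb hba
        rw [if_neg]
        intro hab
        exact hba (hidx b (hsA (Finset.mem_filter.1 hb).1) a (hsA ha) hab.symm)
      · intro h
        exact absurd (Finset.mem_filter.2 ⟨ha, hap⟩) h
    have hxp : x ∈ Set.range p := by
      by_contra hxp
      exact hwx (hoff x hx hxp)
    obtain ⟨i, rfl⟩ := hxp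
    have h4 := sum_mul_affineMap_eq_zero h1 h2 (p.coord i)
    rw [Finset.sum_eq_single (p i)] at h4
    · simp at h4
      exact hwx h4
    · intro b hb hbi
      by_cases hbp : b ∈ Set.range p
      · obtain ⟨j, rfl⟩ := hbp
        rw [AffineBasis.coord_apply_ne _ (by rintro rfl; exact hbi rfl), mul_zero]
      · rw [hoff b hb hbp, zero_mul]
    · intro h
      exact absurd hx h
  obtain ⟨t, ht0, ht⟩ : ∃ t : ℝ, 0 < t ∧ ∀ s ∈ bad, (Q s).eval t ≠ 0 := by
    by_contra! hcon
    have hprod : ∏ s ∈ bad, Q s ≠ 0 := Finset.prod_ne_zero_iff.2 hQ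
    apply hprod
    apply Polynomial.eq_zero_of_infinite_isRoot
    refine (Set.Ioi_infinite (0 : ℝ)).mono fun t ht => ?_
    obtain ⟨s, hs, h0⟩ := hcon t ht
    show Polynomial.eval t _ = 0
    rw [Polynomial.eval_prod]
    exact Finset.prod_eq_zero hs h0
  refine ⟨fun a => if a ∈ Set.range p then 0 else t ^ idx a, fun i => by simp, fun a => ?_, ?_⟩
  · dsimp only
    split_ifs
    · exact le_rfl
    · positivity
  · intro s hsA f hf
    by_contra hs
    obtain ⟨h1, h2, -⟩ := hw s hs
    apply ht s (by simp only [bad, Finset.mem_filter, Finset.mem_powerset]; exact ⟨hsA, hs⟩)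
    have h3 := sum_mul_affineMap_eq_zero h1 h2 f
    rw [← h3]
    simp only [Q, Polynomial.eval_finsetSum, Finset.sum_filter]
    refine Finset.sum_congr rfl fun a ha => ?_
    rw [hf a ha]
    split_ifs <;> simp_all

/-! ### Density of generic points -/

theorem isClosed_segment_plane (a b : Fin 2 → ℝ) : IsClosed (segment ℝ a b) := by
  rw [← convexHull_pair]
  exact ((Set.toFinite _).isCompact_convexHull ℝ).isClosed

theorem dense_compl_segment (a b : Fin 2 → ℝ) : Dense (segment ℝ a b)ᶜ := by
  rw [← interior_eq_empty_iff_dense_compl, ← Set.not_nonempty_iff_eq_empty, ← convexHull_pair,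
    interior_convexHull_nonempty_iff_affineSpan_eq_top]
  intro htop
  have h2 : Module.finrank ℝ (vectorSpan ℝ {a, b}) ≤ 1 :=
    collinear_iff_finrank_le_one.1 (collinear_pair ℝ a b)
  rw [← direction_affineSpan, htop, AffineSubspace.direction_top] at h2
  simp at h2

theorem dense_generic (A : Finset (Fin 2 → ℝ)) : Dense {x | Generic A x} := by
  have hfin : ∀ S : Finset ((Fin 2 → ℝ) × (Fin 2 → ℝ)),
      IsOpen {x | ∀ q ∈ S, x ∉ segment ℝ q.1 q.2} ∧
        Dense {x | ∀ q ∈ S, x ∉ segment ℝ q.1 q.2} := by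
    classical
    intro S
    induction S using Finset.induction_on with
    | empty => simp
    | insert q S _ ih =>
      have h : {x | ∀ q' ∈ insert q S, x ∉ segment ℝ q'.1 q'.2} =
          (segment ℝ q.1 q.2)ᶜ ∩ {x | ∀ q ∈ S, x ∉ segment ℝ q.1 q.2} := by
        ext x
        simp
      rw [h]
      have ho := (isClosed_segment_plane q.1 q.2).isOpen_compl
      exact ⟨ho.inter ih.1, (dense_compl_segment q.1 q.2).inter_of_isOpen_left ih.2 ho⟩
  refine (hfin (A ×ˢ A)).2.mono fun x hx a ha b hb => ?_
  exact hx (a, b) (Finset.mem_product.2 ⟨ha, hb⟩)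

theorem subset_closure_generic {P : Set (Fin 2 → ℝ)} (hc : Convex ℝ P)
    (hP : (interior P).Nonempty) (A : Finset (Fin 2 → ℝ)) :
    P ⊆ closure (interior P ∩ {x | Generic A x}) := by
  intro x hx
  have h1 := hc.closure_interior_eq_closure_of_nonempty_interior hP
  have h2 := (dense_generic A).open_subset_closure_inter (isOpen_interior (s := P))
  rw [← closure_closure]
  exact closure_mono h2 (h1 ▸ subset_closure hx)

/-- The regular triangulation given by generic heights `ω` that vanish on the triangle: its faces
are the nonempty sets on which some affine minorant of `ω` is tight. Genericity makes them
simplices, and the zero function supports the given triangle. -/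
theorem exists_triangulation (A : Finset (Fin 2 → ℝ))
    (p : AffineBasis (Fin 3) ℝ (Fin 2 → ℝ)) (hp : ∀ i, p i ∈ A) :
    ∃ K : Geometry.SimplicialComplex ℝ (Fin 2 → ℝ), K.space = convexHull ℝ (A : Set (Fin 2 → ℝ)) ∧
      (∀ s ∈ K.faces, s ⊆ A) ∧ Finset.univ.image p ∈ K.faces := by
  classical
  obtain ⟨ω, hωp, hω0, hω⟩ := exists_generic_height A p
  let F : Set (Finset (Fin 2 → ℝ)) := {s | s ⊆ A ∧ ∃ f : (Fin 2 → ℝ) →ᵃ[ℝ] ℝ,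
    (∀ a ∈ A, f a ≤ ω a) ∧ ∀ a ∈ s, f a = ω a}
  have hind : ∀ s ∈ F, AffineIndependent ℝ ((↑) : s → Fin 2 → ℝ) := by
    rintro s ⟨hs, f, -, hf⟩
    exact hω s hs f hf
  have hinter : ∀ᵉ (s ∈ F) (t ∈ F),
      convexHull ℝ ↑s ∩ convexHull ℝ ↑t ⊆ convexHull ℝ (s ∩ t : Set (Fin 2 → ℝ)) := by
    rintro s ⟨hs, f, hfA, hf⟩ t ⟨ht, g, hgA, hg⟩ x ⟨hxs, hxt⟩
    rw [Finset.mem_convexHull'] at hxs hxt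
    obtain ⟨u, hu0, hu1, hux⟩ := hxs
    obtain ⟨v, hv0, hv1, hvx⟩ := hxt
    have happ : ∀ (h : (Fin 2 → ℝ) →ᵃ[ℝ] ℝ) (r : Finset (Fin 2 → ℝ)) (w : (Fin 2 → ℝ) → ℝ),
        ∑ y ∈ r, w y = 1 → ∑ y ∈ r, w y • y = x → h x = ∑ y ∈ r, w y * h y := by
      intro h r w h1 h2
      exact (sum_mul_affineMap_eq h2 h1 h).symm
    -- Each of `f` and `g` equals `ω` on its own simplex and lies below it elsewhere, so they agree
    -- at `x`. Hence the weights `u` are supported where `g` is tight.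
    have h1 : g x ≤ f x := by
      rw [happ g s u hu1 hux, happ f s u hu1 hux]
      refine Finset.sum_le_sum fun a ha => mul_le_mul_of_nonneg_left ?_ (hu0 a ha)
      rw [hf a ha]
      exact hgA a (hs ha)
    have h2 : f x ≤ g x := by
      rw [happ g t v hv1 hvx, happ f t v hv1 hvx]
      refine Finset.sum_le_sum fun a ha => mul_le_mul_of_nonneg_left ?_ (hv0 a ha)
      rw [hg a ha]
      exact hfA a (ht ha)
    have h3 : ∑ a ∈ s, u a * (ω a - g a) = 0 := by
      simp_rw [mul_sub, Finset.sum_sub_distrib]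
      rw [← happ g s u hu1 hux, ← le_antisymm h2 h1, happ f s u hu1 hux, sub_eq_zero]
      exact Finset.sum_congr rfl fun a ha => by rw [hf a ha]
    have h4 : ∀ a ∈ s, u a * (ω a - g a) = 0 :=
      (Finset.sum_eq_zero_iff_of_nonneg fun a ha =>
        mul_nonneg (hu0 a ha) (sub_nonneg.2 (hgA a (hs ha)))).1 h3
    -- both representations of `x` are supported on the contact set of `g`
    let r := A.filter fun a => g a = ω a
    have hr : AffineIndependent ℝ ((↑) : r → Fin 2 → ℝ) :=
      hω r (Finset.filter_subset _ _) g fun a ha => (Finset.mem_filter.1 ha).2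
    let u' : (Fin 2 → ℝ) → ℝ := fun a => if a ∈ s then u a else 0
    let v' : (Fin 2 → ℝ) → ℝ := fun a => if a ∈ t then v a else 0
    have hu' : ∀ a ∉ r, u' a = 0 := by
      intro a ha
      simp only [u']
      split_ifs with has
      · have := h4 a has
        rcases mul_eq_zero.1 this with h | h
        · exact h
        · exact absurd (Finset.mem_filter.2 ⟨hs has, by linarith⟩) ha
      · rfl
    have htr : t ⊆ r := fun a ha => Finset.mem_filter.2 ⟨ht ha, hg a ha⟩
    have hsum : ∀ {M : Type} [AddCommMonoid M] [Module ℝ M] (φ : (Fin 2 → ℝ) → M),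
        ∑ a ∈ r, u' a • φ a = ∑ a ∈ s, u a • φ a := by
      intro M _ _ φ
      have e1 : ∑ a ∈ r, u' a • φ a = ∑ a ∈ A, u' a • φ a := by
        refine Finset.sum_subset (Finset.filter_subset _ _) fun a _ ha => by rw [hu' a ha, zero_smul]
      rw [e1, ← Finset.sum_subset hs]
      · exact Finset.sum_congr rfl fun a ha => by simp [u', ha]
      · intro a _ ha
        simp [u', ha]
    have hsum' : ∀ {M : Type} [AddCommMonoid M] [Module ℝ M] (φ : (Fin 2 → ℝ) → M),
        ∑ a ∈ r, v' a • φ a = ∑ a ∈ t, v a • φ a := by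
      intro M _ _ φ
      rw [← Finset.sum_subset htr]
      · exact Finset.sum_congr rfl fun a ha => by simp [v', ha]
      · intro a _ ha
        simp [v', ha]
    have huv : ∀ a ∈ r, u' a = v' a := by
      have e0 := hsum (fun _ => (1 : ℝ))
      have e1 := hsum' (fun _ => (1 : ℝ))
      have e2 := hsum id
      have e3 := hsum' id
      simp only [smul_eq_mul, mul_one, id] at e0 e1 e2 e3
      have := affineIndependent_iff.1 hr Finset.univ (fun a => u' a - v' a)
        (by rw [Finset.sum_coe_sort r (fun a => u' a - v' a), Finset.sum_sub_distrib, e0, e1, hu1,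
              hv1, sub_self])
        (by rw [Finset.sum_coe_sort r (fun a => (u' a - v' a) • a)]
            simp_rw [sub_smul, Finset.sum_sub_distrib]
            rw [e2, e3, hux, hvx, sub_self])
      intro a ha
      exact sub_eq_zero.1 (this ⟨a, ha⟩ (Finset.mem_univ _))
    rw [← Finset.coe_inter, Finset.mem_convexHull']
    have hoff : ∀ a ∈ s, a ∉ s ∩ t → u a = 0 := by
      intro a has hat
      have hat' : a ∉ t := fun h => hat (Finset.mem_inter.2 ⟨has, h⟩)
      by_cases har : a ∈ r
      · have := huv a har
        simpa [u', v', has, hat'] using this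
      · simpa [u', has] using hu' a har
    refine ⟨u, fun a ha => hu0 a (Finset.mem_inter.1 ha).1, ?_, ?_⟩
    · rw [← hu1]
      exact Finset.sum_subset Finset.inter_subset_left hoff
    · rw [← hux]
      exact Finset.sum_subset Finset.inter_subset_left fun a ha ha' => by
        rw [hoff a ha ha', zero_smul]
  let K := Geometry.SimplicialComplex.ofErase F hind
    (fun s t hts ⟨hs, f, hfA, hf⟩ => ⟨hts.trans hs, f, hfA, fun a ha => hf a (hts ha)⟩) hinter
  have hK : ∀ s, s ∈ K.faces ↔ s ∈ F ∧ s ≠ ∅ := fun s => by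
    show s ∈ F \ {∅} ↔ _
    simp
  refine ⟨K, ?_, fun s hs => ((hK s).1 hs).1.1, (hK _).2 ⟨⟨?_, AffineMap.const ℝ _ 0, ?_, ?_⟩, ?_⟩⟩
  · apply Set.Subset.antisymm
    · intro x hx
      obtain ⟨s, hs, hxs⟩ := Geometry.SimplicialComplex.mem_space_iff.1 hx
      exact convexHull_mono (by exact_mod_cast ((hK s).1 hs).1.1) hxs
    -- Generic points are dense in the hull and the space of `K` is closed, so covering the generic
    -- points suffices; duality gives each of them a supporting triangle.
    · have hint : (interior (convexHull ℝ (A : Set (Fin 2 → ℝ)))).Nonempty := by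
        rw [interior_convexHull_nonempty_iff_affineSpan_eq_top, eq_top_iff, ← p.tot]
        apply affineSpan_mono
        rintro _ ⟨i, rfl⟩
        exact hp i
      have hclosed : IsClosed K.space := by
        have hfin : K.faces.Finite :=
          (A.powerset.finite_toSet).subset fun s hs => by
            simpa using ((hK s).1 hs).1.1
        rw [Geometry.SimplicialComplex.space]
        exact hfin.isClosed_biUnion fun s _ =>
          (s.finite_toSet.isCompact_convexHull ℝ).isClosed
      refine (subset_closure_generic (convex_convexHull ℝ _) hint A).trans
        (closure_minimal ?_ hclosed)
      rintro x ⟨hx, hgen⟩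
      obtain ⟨q, hqA, hq0, hq⟩ := Generic.exists_interp_le hgen (interior_subset hx) ω
      refine Geometry.SimplicialComplex.mem_space_iff.2 ⟨Finset.univ.image q, (hK _).2
        ⟨⟨?_, interp q ω, hq, ?_⟩, ?_⟩, ?_⟩
      · intro a ha
        obtain ⟨i, -, rfl⟩ := Finset.mem_image.1 ha
        exact hqA i
      · intro a ha
        obtain ⟨i, -, rfl⟩ := Finset.mem_image.1 ha
        exact interp_basis _ _ _
      · exact (Finset.univ_nonempty.image q).ne_empty
      · rw [Finset.coe_image, Finset.coe_univ, Set.image_univ, AffineBasis.convexHull_eq_nonneg_coord]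
        exact fun i => (hq0 i).le
  · intro a ha
    obtain ⟨i, -, rfl⟩ := Finset.mem_image.1 ha
    exact hp i
  · exact fun a _ => hω0 a
  · intro a ha
    obtain ⟨i, -, rfl⟩ := Finset.mem_image.1 ha
    simp [hωp]
  · exact (Finset.univ_nonempty.image p).ne_empty

/-! ### Regions of the chamber complex -/

theorem IsLatticePolygon.exists_points {P : Set (Fin 2 → ℝ)} (hP : IsLatticePolygon P) :
    ∃ A : Finset (Fin 2 → ℤ), (∀ a, a ∈ A ↔ toReal a ∈ P) ∧
      P = convexHull ℝ (toReal '' (A : Set (Fin 2 → ℤ))) := by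
  obtain ⟨⟨V, hV⟩, -⟩ := hP
  have hcomp : IsCompact P := by
    rw [hV]
    exact (V.finite_toSet.image _).isCompact_convexHull ℝ
  obtain ⟨M, hM⟩ := hcomp.isBounded.exists_norm_le
  have hfin : {a : Fin 2 → ℤ | toReal a ∈ P}.Finite := by
    refine (Set.finite_Icc (fun _ => -⌈M⌉) (fun _ => ⌈M⌉)).subset fun a ha => ?_
    have h : ∀ i, |(a i : ℝ)| ≤ M := fun i => (norm_le_pi_norm (toReal a) i).trans (hM _ ha)
    constructor <;> intro i
    · have h1 := (abs_le.1 (h i)).1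
      have h2 := Int.le_ceil M
      have : (-⌈M⌉ : ℝ) ≤ a i := by linarith
      exact_mod_cast this
    · have h1 := (abs_le.1 (h i)).2
      have h2 := Int.le_ceil M
      have : (a i : ℝ) ≤ ⌈M⌉ := by linarith
      exact_mod_cast this
  refine ⟨hfin.toFinset, fun a => by simp, ?_⟩
  apply Set.Subset.antisymm
  · conv_lhs => rw [hV]
    apply convexHull_mono
    apply Set.image_mono
    intro a ha
    simp only [Set.Finite.coe_toFinset, Set.mem_ofPred_eq]
    rw [hV]
    exact subset_convexHull _ _ (Set.mem_image_of_mem _ ha)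
  · refine convexHull_min ?_ (by rw [hV]; exact convex_convexHull _ _)
    rintro _ ⟨a, ha, rfl⟩
    simpa using ha

theorem convexHull_range_subset {A : Finset (Fin 2 → ℝ)}
    {p : AffineBasis (Fin 3) ℝ (Fin 2 → ℝ)} (hp : ∀ i, p i ∈ A) :
    convexHull ℝ (Set.range p) ⊆ convexHull ℝ (A : Set (Fin 2 → ℝ)) :=
  convexHull_mono (by rintro _ ⟨i, rfl⟩; exact hp i)

/-- An affinely independent set in the plane whose hull has interior points is a triangle. -/
theorem exists_basis_of_interior_nonempty {s : Finset (Fin 2 → ℝ)}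
    (hs : AffineIndependent ℝ ((↑) : s → Fin 2 → ℝ))
    (hint : (interior (convexHull ℝ (s : Set (Fin 2 → ℝ)))).Nonempty) :
    s.card = 3 ∧ ∃ p : AffineBasis (Fin 3) ℝ (Fin 2 → ℝ), Set.range p = s := by
  rw [interior_convexHull_nonempty_iff_affineSpan_eq_top] at hint
  let p0 : AffineBasis s ℝ (Fin 2 → ℝ) := ⟨(↑), hs, by
    simpa using hint⟩
  have hcard : s.card = 3 := by
    have := (hs.affineSpan_eq_top_iff_card_eq_finrank_add_one).1 p0.tot
    simpa using this
  refine ⟨hcard, p0.reindex (s.equivFinOfCardEq hcard), ?_⟩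
  rw [AffineBasis.coe_reindex, Set.range_comp, Equiv.range_eq_univ, Set.image_univ]
  exact Subtype.range_coe

section Region

variable {P R : Set (Fin 2 → ℝ)} {A : Finset (Fin 2 → ℝ)}

theorem IsRegion.subset (hR : IsRegion P R) : R ⊆ P := by
  obtain ⟨-, σ, -, rfl⟩ := hR
  exact Set.inter_subset_left

theorem IsRegion.convex (hR : IsRegion P R) (hP : Convex ℝ P) : Convex ℝ R := by
  obtain ⟨-, σ, -, rfl⟩ := hR
  exact hP.inter (convex_iInter₂ fun _ _ => convex_convexHull _ _)

theorem IsRegion.isClosed (hR : IsRegion P R) (hP : IsClosed P) : IsClosed R := by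
  obtain ⟨-, σ, -, rfl⟩ := hR
  exact hP.inter (isClosed_iInter fun K => isClosed_iInter fun _ =>
    ((σ K).finite_toSet.isCompact_convexHull ℝ).isClosed)

/-- Compare the triangle with the face `σ K ⊇ R` of a triangulation `K` that contains it. If the
interior of `R` meets the triangle, the common face of the two has interior points, hence three
vertices, and the two faces coincide. -/
theorem IsRegion.subset_or_disjoint (hR : IsRegion P R)
    (hP : P = convexHull ℝ (A : Set (Fin 2 → ℝ))) (hA : ∀ a ∈ A, a ∈ Set.range toReal)
    (p : AffineBasis (Fin 3) ℝ (Fin 2 → ℝ)) (hp : ∀ i, p i ∈ A) :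
    R ⊆ convexHull ℝ (Set.range p) ∨ Disjoint (interior R) (convexHull ℝ (Set.range p)) := by
  classical
  obtain ⟨-, σ, hσ, hRσ⟩ := hR
  obtain ⟨K, hK, hKA, hpK⟩ := exists_triangulation A p hp
  have hKt : IsLatticeTriangulation P K :=
    ⟨hK.trans hP.symm, fun x hx => hA _ (by simpa using hKA _ hx)⟩
  rw [or_iff_not_imp_right, Set.not_disjoint_iff_nonempty_inter]
  intro hne
  have hRK : R ⊆ convexHull ℝ (σ K : Set (Fin 2 → ℝ)) := by
    rw [hRσ]
    exact Set.inter_subset_right.trans (Set.iInter₂_subset K hKt)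
  have hpint : (interior (convexHull ℝ (Set.range p))).Nonempty :=
    ⟨_, p.centroid_mem_interior_convexHull⟩
  have hcl := (convex_convexHull ℝ (Set.range p)).closure_interior_eq_closure_of_nonempty_interior
    hpint
  have hne2 : (interior R ∩ interior (convexHull ℝ (Set.range p))).Nonempty := by
    obtain ⟨x, hx, hxp⟩ := hne
    have : x ∈ closure (interior (convexHull ℝ (Set.range p))) := hcl ▸ subset_closure hxp
    exact mem_closure_iff.1 this _ isOpen_interior hx
  let T : Finset (Fin 2 → ℝ) := Finset.univ.image p
  have hT : (T : Set (Fin 2 → ℝ)) = Set.range p := by simp [T]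
  have hsub : interior R ∩ interior (convexHull ℝ (Set.range p)) ⊆
      convexHull ℝ ((σ K ∩ T : Finset _) : Set (Fin 2 → ℝ)) := by
    rw [Finset.coe_inter]
    intro x hx
    refine K.inter_subset_convexHull (hσ K hKt) hpK ⟨hRK (interior_subset hx.1), ?_⟩
    rw [show ((Finset.univ.image p : Finset _) : Set (Fin 2 → ℝ)) = _ from hT]
    exact interior_subset hx.2
  have hint : (interior (convexHull ℝ ((σ K ∩ T : Finset _) : Set (Fin 2 → ℝ)))).Nonempty :=
    hne2.mono (interior_maximal hsub (isOpen_interior.inter isOpen_interior))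
  have hface : σ K ∩ T ∈ K.faces := K.down_closed hpK Finset.inter_subset_right (by
    rw [← Finset.coe_nonempty, ← convexHull_nonempty_iff (𝕜 := ℝ)]
    exact hint.mono interior_subset)
  have h1 := (exists_basis_of_interior_nonempty (K.indep hface) hint).1
  have hTc : T.card = 3 := by
    rw [Finset.card_image_of_injective _ p.ind.injective]
    simp
  have h2 := (exists_basis_of_interior_nonempty (K.indep (hσ K hKt)) (hint.mono
    (interior_mono (convexHull_mono (by exact_mod_cast Finset.inter_subset_left))))).1
  have e1 : σ K ∩ T = T := Finset.eq_of_subset_of_card_le Finset.inter_subset_right (by omega)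
  have e2 : σ K ∩ T = σ K := Finset.eq_of_subset_of_card_le Finset.inter_subset_left (by omega)
  rw [← hT, ← e1, e2]
  exact hRK

/-- A region contains every point that lies in all the triangles that contain the region. -/
theorem IsRegion.mem_of_forall (hR : IsRegion P R)
    (hP : P = convexHull ℝ (A : Set (Fin 2 → ℝ)))
    (hA : ∀ a ∈ A, a ∈ Set.range toReal) (hPA : ∀ a ∈ P, a ∈ Set.range toReal → a ∈ A)
    {x : Fin 2 → ℝ} (hx : ∀ p : AffineBasis (Fin 3) ℝ (Fin 2 → ℝ), (∀ i, p i ∈ A) →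
      R ⊆ convexHull ℝ (Set.range p) → x ∈ convexHull ℝ (Set.range p)) : x ∈ R := by
  have hR' := hR
  obtain ⟨hne, σ, hσ, hRσ⟩ := hR'
  rw [hRσ]
  constructor
  · obtain ⟨r, hr, hgen⟩ := (dense_generic A).inter_open_nonempty _ isOpen_interior hne
    have hrP : r ∈ convexHull ℝ (A : Set (Fin 2 → ℝ)) := hP ▸ hR.subset (interior_subset hr)
    obtain ⟨p, hpA, hp⟩ := Generic.exists_basis hgen hrP
    rw [hP]
    refine convexHull_range_subset hpA (hx p hpA ?_)
    refine (hR.subset_or_disjoint hP hA p hpA).resolve_right fun h => ?_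
    refine Set.disjoint_left.1 h hr ?_
    rw [AffineBasis.convexHull_eq_nonneg_coord]
    exact fun i => (hp i).le
  -- Each selected face contains `R`, so it has interior points and is itself a triangle on `A`.
  · rw [Set.mem_iInter₂]
    intro K hK
    have hRK : R ⊆ convexHull ℝ (σ K : Set (Fin 2 → ℝ)) := by
      rw [hRσ]
      exact Set.inter_subset_right.trans (Set.iInter₂_subset K hK)
    obtain ⟨-, p, hp⟩ := exists_basis_of_interior_nonempty (K.indep (hσ K hK))
      (hne.mono (interior_mono hRK))
    rw [← hp] at hRK ⊢
    refine hx p (fun i => ?_) hRK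
    have hi : p i ∈ σ K := by
      have := Set.mem_range_self (f := p) i
      rw [hp] at this
      exact this
    refine hPA _ ?_ (hK.2 ?_)
    · rw [← hK.1]
      exact Geometry.SimplicialComplex.subset_space (hσ K hK) hi
    · exact K.down_closed (hσ K hK) (by simpa using hi) (Finset.singleton_nonempty _)

theorem IsRegion.subset_of_mem (hR : IsRegion P R)
    (hP : P = convexHull ℝ (A : Set (Fin 2 → ℝ))) (hA : ∀ a ∈ A, a ∈ Set.range toReal)
    (p : AffineBasis (Fin 3) ℝ (Fin 2 → ℝ)) (hp : ∀ i, p i ∈ A) {r : Fin 2 → ℝ}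
    (hr : r ∈ interior R) (hrp : ∀ i, 0 ≤ p.coord i r) : R ⊆ convexHull ℝ (Set.range p) := by
  refine (hR.subset_or_disjoint hP hA p hp).resolve_right fun h => ?_
  refine Set.disjoint_left.1 h hr ?_
  rw [AffineBasis.convexHull_eq_nonneg_coord]
  exact hrp

/-- If `r` were on a segment `ab`, a triangle `abc` on `A` would contain `r`, hence `R`. Then `r`
would be interior to the triangle although its coordinate at `c` is zero. -/
theorem IsRegion.generic (hR : IsRegion P R)
    (hP : P = convexHull ℝ (A : Set (Fin 2 → ℝ))) (hA : ∀ a ∈ A, a ∈ Set.range toReal)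
    {r : Fin 2 → ℝ} (hr : r ∈ interior R) : Generic A r := by
  have hspan : affineSpan ℝ (A : Set (Fin 2 → ℝ)) = ⊤ := by
    rw [← interior_convexHull_nonempty_iff_affineSpan_eq_top, ← hP]
    exact ⟨r, interior_mono hR.subset hr⟩
  have key : ∀ a ∈ A, ∀ b ∈ A, a ≠ b → r ∉ segment ℝ a b := by
    intro a ha b hb hab hrab
    obtain ⟨c, hc, hcab⟩ : ∃ c ∈ A, c ∉ line[ℝ, a, b] := by
      by_contra! h
      have h1 : affineSpan ℝ (A : Set (Fin 2 → ℝ)) ≤ line[ℝ, a, b] := affineSpan_le.2 h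
      rw [hspan, top_le_iff] at h1
      have h2 : Module.finrank ℝ (vectorSpan ℝ {a, b}) ≤ 1 :=
        collinear_iff_finrank_le_one.1 (collinear_pair ℝ a b)
      rw [← direction_affineSpan, h1, AffineSubspace.direction_top] at h2
      simp at h2
    have hind := affineIndependent_of_ne_of_mem_of_mem_of_notMem hab
      (left_mem_affineSpan_pair ℝ a b) (right_mem_affineSpan_pair ℝ a b) hcab
    let p : AffineBasis (Fin 3) ℝ (Fin 2 → ℝ) := ⟨![a, b, c], hind,
      (hind.affineSpan_eq_top_iff_card_eq_finrank_add_one).2 (by simp)⟩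
    have hpA : ∀ i, p i ∈ A := by
      intro i
      show ![a, b, c] i ∈ A
      fin_cases i
      exacts [ha, hb, hc]
    obtain ⟨s, t, hs, ht, hst, hr'⟩ := hrab
    have hc : ∀ i, p.coord i r = ![s, t, 0] i := by
      apply coord_eq_of_sum p
      · simp [Fin.sum_univ_three, hst]
      · rw [Fin.sum_univ_three]
        show s • a + t • b + (0 : ℝ) • c = r
        simp [hr']
    have hsub := hR.subset_of_mem hP hA p hpA hr (by
      intro i
      rw [hc]
      fin_cases i <;> simp [hs, ht])
    have := interior_mono hsub hr
    rw [AffineBasis.interior_convexHull] at this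
    have := this 2
    rw [hc] at this
    simp at this
  intro a ha b hb hrab
  -- A degenerate segment means that `r` itself is in `A`; then it is an endpoint of a nondegenerate
  -- one.
  by_cases hab : a = b
  · subst hab
    rw [segment_same, Set.mem_singleton_iff] at hrab
    subst hrab
    obtain ⟨b, hb, hne⟩ : ∃ b ∈ A, r ≠ b := by
      by_contra! h
      have h1 : (A : Set (Fin 2 → ℝ)) ⊆ {r} := fun b hb => (h b hb).symm
      have h2 := affineSpan_mono ℝ h1
      rw [hspan, top_le_iff] at h2
      have h3 : Module.finrank ℝ (vectorSpan ℝ {r}) = 0 := by simp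
      rw [← direction_affineSpan, h2, AffineSubspace.direction_top] at h3
      simp at h3
    exact key r ha b hb hne (left_mem_segment ℝ _ _)
  · exact key a ha b hb hab hrab

/-- By genericity `r` lies in a triangle with vertices in `D`, and that triangle contains all of
`R`. -/
theorem IsRegion.mem_convexHull_of_mem (hR : IsRegion P R)
    (hP : P = convexHull ℝ (A : Set (Fin 2 → ℝ))) (hA : ∀ a ∈ A, a ∈ Set.range toReal)
    {r r' : Fin 2 → ℝ} (hr : r ∈ interior R) (hr' : r' ∈ R) {D : Finset (Fin 2 → ℝ)}
    (hD : D ⊆ A) (hrD : r ∈ convexHull ℝ (D : Set (Fin 2 → ℝ))) :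
    r' ∈ convexHull ℝ (D : Set (Fin 2 → ℝ)) := by
  obtain ⟨p, hpD, hp⟩ := ((hR.generic hP hA hr).mono hD).exists_basis hrD
  exact convexHull_range_subset hpD
    (hR.subset_of_mem hP hA p (fun i => hD (hpD i)) hr (fun i => (hp i).le) hr')

end Region

/-! ### Empty lattice triangles and integral support functions -/

/-- Empty lattice triangles are unimodular. Subtracting integral multiples of the edges moves a
lattice point into the fundamental parallelogram, made of the triangle and its reflection; emptiness
leaves only vertices. -/
theorem exists_int_coord_of_empty (p : AffineBasis (Fin 3) ℝ (Fin 2 → ℝ))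
    (hp : ∀ i, p i ∈ Set.range toReal)
    (hempty : ∀ z : Fin 2 → ℤ, toReal z ∈ convexHull ℝ (Set.range p) → toReal z ∈ Set.range p)
    (z : Fin 2 → ℤ) (i : Fin 3) : ∃ n : ℤ, p.coord i (toReal z) = n := by
  choose q hq using hp
  have h1 := p.sum_coord_apply_eq_one (toReal z)
  have h2 := p.linear_combination_coord_eq_self (toReal z)
  rw [Fin.sum_univ_three] at h1 h2
  set l0 := p.coord 0 (toReal z)
  set l1 := p.coord 1 (toReal z) with hl1
  set l2 := p.coord 2 (toReal z) with hl2
  have f1 := Int.fract_nonneg l1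
  have f1' := Int.fract_lt_one l1
  have f2 := Int.fract_nonneg l2
  have f2' := Int.fract_lt_one l2
  have hcomb : ∀ (y : Fin 2 → ℤ) (w : Fin 3 → ℝ), w 0 + w 1 + w 2 = 1 →
      w 0 • p 0 + w 1 • p 1 + w 2 • p 2 = toReal y → (∀ i, 0 ≤ w i) →
      ∃ j, ∀ i, w i = if i = j then 1 else 0 := by
    intro y w hw hy hw0
    have hc := coord_eq_of_sum p (w := w) (x := toReal y) (by rw [Fin.sum_univ_three, hw])
      (by rw [Fin.sum_univ_three, hy])
    obtain ⟨j, hj⟩ := hempty y (by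
      rw [AffineBasis.convexHull_eq_nonneg_coord]
      intro i
      rw [hc]
      exact hw0 i)
    exact ⟨j, fun i => by rw [← hc i, ← hj, AffineBasis.coord_apply]⟩
  have hz' : ∃ z' : Fin 2 → ℤ, (1 - Int.fract l1 - Int.fract l2) • p 0 + Int.fract l1 • p 1 +
      Int.fract l2 • p 2 = toReal z' := by
    refine ⟨z - ⌊l1⌋ • (q 1 - q 0) - ⌊l2⌋ • (q 2 - q 0), ?_⟩
    ext i
    have h3 := congrFun h2 i
    have e0 := congrFun (hq 0) i
    have e1 := congrFun (hq 1) i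
    have e2 := congrFun (hq 2) i
    simp only [toReal, Pi.add_apply, Pi.smul_apply, Pi.sub_apply, smul_eq_mul, Int.cast_sub,
      Int.cast_mul, Int.fract] at h3 e0 e1 e2 ⊢
    rw [← h3, e0, e1, e2, show l0 = 1 - l1 - l2 by linarith]
    ring
  obtain ⟨z', hz'⟩ := hz'
  have hfr : Int.fract l1 = 0 ∧ Int.fract l2 = 0 := by
    rcases le_or_gt (Int.fract l1 + Int.fract l2) 1 with hle | hgt
    · obtain ⟨j, hj⟩ := hcomb z' ![1 - Int.fract l1 - Int.fract l2, Int.fract l1, Int.fract l2]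
        (by simp only [Matrix.cons_val]; ring) (by simpa using hz') (by
          intro i
          fin_cases i
          · show 0 ≤ 1 - Int.fract l1 - Int.fract l2
            linarith
          · exact f1
          · exact f2)
      have j1 := hj 1
      have j2 := hj 2
      simp only [Matrix.cons_val] at j1 j2
      constructor
      · rw [j1]
        split_ifs at j1 ⊢ <;> linarith
      · rw [j2]
        split_ifs at j2 ⊢ <;> linarith
    -- In the other half, the reflection `q 1 + q 2 - z'` lies in the triangle with two positive
    -- coordinates, so it cannot be a vertex.
    · exfalso
      obtain ⟨j, hj⟩ := hcomb (q 1 + q 2 - z')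
        ![Int.fract l1 + Int.fract l2 - 1, 1 - Int.fract l1, 1 - Int.fract l2]
        (by simp) (by
          ext i
          have h3 := congrFun hz' i
          have e1 := congrFun (hq 1) i
          have e2 := congrFun (hq 2) i
          simp [toReal] at h3 e1 e2 ⊢
          rw [← h3, e1, e2]
          ring) (by
          intro i
          fin_cases i
          · show 0 ≤ Int.fract l1 + Int.fract l2 - 1
            linarith
          · show 0 ≤ 1 - Int.fract l1
            linarith
          · show 0 ≤ 1 - Int.fract l2
            linarith)
      have j1 := hj 1
      have j2 := hj 2
      simp only [Matrix.cons_val] at j1 j2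
      split_ifs at j1 j2 with a b
      · rw [← a] at b
        exact absurd b (by decide)
      all_goals linarith
  have g1 : l1 = ⌊l1⌋ := by have := Int.floor_add_fract l1; linarith [hfr.1]
  have g2 : l2 = ⌊l2⌋ := by have := Int.floor_add_fract l2; linarith [hfr.2]
  fin_cases i
  · refine ⟨1 - ⌊l1⌋ - ⌊l2⌋, ?_⟩
    show l0 = _
    push_cast
    linarith
  · exact ⟨_, g1⟩
  · exact ⟨_, g2⟩

/-- A Delaunay triangle: with heights `|y| ^ 2`, strict convexity puts every nonvertex point of a
triangle strictly below the interpolant, while no point of `S` lies below a minimising one. -/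
theorem Generic.exists_empty_basis {S : Finset (Fin 2 → ℝ)} {x : Fin 2 → ℝ} (h : Generic S x)
    (hx : x ∈ convexHull ℝ (S : Set (Fin 2 → ℝ)))
    (hS : ∀ z : Fin 2 → ℤ, toReal z ∈ convexHull ℝ (S : Set (Fin 2 → ℝ)) → toReal z ∈ S) :
    ∃ p : AffineBasis (Fin 3) ℝ (Fin 2 → ℝ), (∀ i, p i ∈ S) ∧ (∀ i, 0 < p.coord i x) ∧
      ∀ z : Fin 2 → ℤ, toReal z ∈ convexHull ℝ (Set.range p) → toReal z ∈ Set.range p := by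
  obtain ⟨p, hpS, hp, hle⟩ := h.exists_interp_le hx fun y => y 0 ^ 2 + y 1 ^ 2
  refine ⟨p, hpS, hp, fun z hz => ?_⟩
  have h1 := hle _ (hS z (convexHull_range_subset hpS hz))
  rw [AffineBasis.convexHull_eq_nonneg_coord] at hz
  rw [interp_apply] at h1
  set y := toReal z
  have s1 := p.sum_coord_apply_eq_one y
  have s2 := p.linear_combination_coord_eq_self y
  -- The weighted sum of squared distances from `y` to the vertices is the interpolant at `y` minus
  -- `|y| ^ 2`.
  have key : ∑ i, p.coord i y * ((p i 0 - y 0) ^ 2 + (p i 1 - y 1) ^ 2) ≤ 0 := by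
    have e0 := congrFun s2 0
    have e1 := congrFun s2 1
    simp only [Fin.sum_univ_three, Pi.add_apply, Pi.smul_apply, smul_eq_mul] at s1 e0 e1 h1 ⊢
    have : p.coord 0 y * ((p 0 0 - y 0) ^ 2 + (p 0 1 - y 1) ^ 2) +
        p.coord 1 y * ((p 1 0 - y 0) ^ 2 + (p 1 1 - y 1) ^ 2) +
        p.coord 2 y * ((p 2 0 - y 0) ^ 2 + (p 2 1 - y 1) ^ 2) =
        p.coord 0 y * (p 0 0 ^ 2 + p 0 1 ^ 2) + p.coord 1 y * (p 1 0 ^ 2 + p 1 1 ^ 2) +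
        p.coord 2 y * (p 2 0 ^ 2 + p 2 1 ^ 2)
        - 2 * y 0 * (p.coord 0 y * p 0 0 + p.coord 1 y * p 1 0 + p.coord 2 y * p 2 0)
        - 2 * y 1 * (p.coord 0 y * p 0 1 + p.coord 1 y * p 1 1 + p.coord 2 y * p 2 1)
        + (p.coord 0 y + p.coord 1 y + p.coord 2 y) * (y 0 ^ 2 + y 1 ^ 2) := by ring
    rw [this, s1, e0, e1]
    linarith
  have hnn : ∀ i ∈ Finset.univ, 0 ≤ p.coord i y * ((p i 0 - y 0) ^ 2 + (p i 1 - y 1) ^ 2) :=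
    fun i _ => mul_nonneg (hz i) (by positivity)
  have hzero := (Finset.sum_eq_zero_iff_of_nonneg hnn).1 (le_antisymm key (Finset.sum_nonneg hnn))
  obtain ⟨i, hi⟩ : ∃ i, p.coord i y ≠ 0 := by
    by_contra! hcon
    simp [hcon] at s1
  refine ⟨i, ?_⟩
  have h2 := (mul_eq_zero.1 (hzero i (Finset.mem_univ i))).resolve_left hi
  have h3 := sq_nonneg (p i 0 - y 0)
  have h4 := sq_nonneg (p i 1 - y 1)
  have e0 : p i 0 - y 0 = 0 := (pow_eq_zero_iff two_ne_zero).1 (by linarith)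
  have e1 : p i 1 - y 1 = 0 := (pow_eq_zero_iff two_ne_zero).1 (by linarith)
  ext j
  fin_cases j
  exacts [sub_eq_zero.1 e0, sub_eq_zero.1 e1]

/-- The point at height one above `x`. -/
def lift {R : Type*} [One R] (x : Fin 2 → R) : Fin 3 → R := ![x 0, x 1, 1]

theorem toReal_lift (a : Fin 2 → ℤ) : toReal (lift a) = lift (toReal a) := by
  ext i
  fin_cases i <;> simp [toReal, lift]

theorem toReal_dotProduct {m : ℕ} (u v : Fin m → ℤ) :
    toReal u ⬝ᵥ toReal v = ((u ⬝ᵥ v : ℤ) : ℝ) := by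
  simp [toReal, dotProduct]

theorem toReal_dotProduct_lift (u : Fin 3 → ℤ) (a : Fin 2 → ℤ) :
    toReal u ⬝ᵥ lift (toReal a) = ((u ⬝ᵥ lift a : ℤ) : ℝ) := by
  rw [← toReal_lift, toReal_dotProduct]

/-- The affine function `x ↦ v · (x, 1)`. -/
def dotLift (v : Fin 3 → ℝ) : (Fin 2 → ℝ) →ᵃ[ℝ] ℝ where
  toFun x := v ⬝ᵥ lift x
  linear := v 0 • LinearMap.proj 0 + v 1 • LinearMap.proj 1
  map_vadd' x y := by
    simp [lift, dotProduct, Fin.sum_univ_three]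
    ring

theorem dotLift_apply (v : Fin 3 → ℝ) (x : Fin 2 → ℝ) : dotLift v x = v ⬝ᵥ lift x := rfl

theorem exists_int_dotLift (f : (Fin 2 → ℝ) →ᵃ[ℝ] ℝ)
    (hf : ∀ z : Fin 2 → ℤ, ∃ n : ℤ, f (toReal z) = n) :
    ∃ v : Fin 3 → ℤ, ∀ x, f x = toReal v ⬝ᵥ lift x := by
  choose n hn using hf
  refine ⟨![n (Pi.single 0 1) - n 0, n (Pi.single 1 1) - n 0, n 0], fun x => ?_⟩
  have hdec : ∀ y, f y = f.linear y + f 0 := fun y => congrFun f.decomp y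
  have e0 : f 0 = n 0 := by
    rw [← hn]
    congr 1
    ext
    simp [toReal]
  have es : ∀ i : Fin 2, f.linear (Pi.single i 1) = n (Pi.single i 1) - n 0 := by
    intro i
    rw [← hn, ← e0, eq_sub_iff_add_eq, ← hdec]
    congr 1
    ext j
    by_cases h : j = i
    · subst h
      simp [toReal]
    · simp [toReal, h]
  rw [hdec, LinearMap.pi_apply_eq_sum_univ f.linear x, e0]
  have es' : ∀ i : Fin 2, f.linear (fun j => if i = j then 1 else 0) = n (Pi.single i 1) - n 0 := by
    intro i
    rw [← es]
    congr 1
    ext j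
    simp [Pi.single_apply, eq_comm]
  simp only [es', Fin.sum_univ_two, dotProduct, Fin.sum_univ_three, toReal, lift]
  simp
  ring

/-- Integrality of the dual linear program, which is where supernormality enters: the largest
affine minorant of `max (u · _) 0` on the lattice points of a polygon is integral at `x`. -/
theorem exists_integral_minorant {A : Finset (Fin 2 → ℤ)} {AR : Finset (Fin 2 → ℝ)}
    (hAR : (AR : Set (Fin 2 → ℝ)) = toReal '' (A : Set (Fin 2 → ℤ)))
    (hA : ∀ z, toReal z ∈ convexHull ℝ (AR : Set (Fin 2 → ℝ)) → z ∈ A) {x : Fin 2 → ℝ}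
    (h : Generic AR x) (hx : x ∈ convexHull ℝ (AR : Set (Fin 2 → ℝ))) (u : Fin 3 → ℤ) :
    ∃ v : Fin 3 → ℤ, (∀ a ∈ A, v ⬝ᵥ lift a ≤ max (u ⬝ᵥ lift a) 0) ∧ 0 ≤ toReal v ⬝ᵥ lift x ∧
      (toReal v ⬝ᵥ lift x = 0 → x ∈ convexHull ℝ (toReal '' {a | a ∈ A ∧ u ⬝ᵥ lift a ≤ 0})) := by
  classical
  have hmem : ∀ a, a ∈ A → toReal a ∈ AR := fun a ha => by
    rw [← Finset.mem_coe, hAR]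
    exact Set.mem_image_of_mem _ ha
  have hmem' : ∀ y ∈ AR, ∃ a ∈ A, toReal a = y := fun y hy => by
    rw [← Finset.mem_coe, hAR] at hy
    exact hy
  let c : (Fin 2 → ℝ) → ℝ := fun y => max (dotLift (toReal u) y) 0
  have hcint : ∀ a : Fin 2 → ℤ, c (toReal a) = ((max (u ⬝ᵥ lift a) 0 : ℤ) : ℝ) := by
    intro a
    simp only [c, dotLift_apply, toReal_dotProduct_lift]
    push_cast
    rfl
  obtain ⟨p, hpA, hp, hle⟩ := h.exists_interp_le hx c
  set f := interp p c with hf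
  let S := AR.filter fun y => f y = c y
  have hSA : S ⊆ AR := Finset.filter_subset _ _
  have hxS : x ∈ convexHull ℝ (S : Set (Fin 2 → ℝ)) := by
    refine convexHull_range_subset (p := p)
      (fun i => Finset.mem_filter.2 ⟨hpA i, interp_basis p c i⟩) ?_
    rw [AffineBasis.convexHull_eq_nonneg_coord]
    exact fun i => (hp i).le
  -- The contact set contains every lattice point of its hull: `c` is convex, so `c ≤ f` there, and
  -- `f ≤ c` holds on all of `A`.
  have hSz : ∀ z : Fin 2 → ℤ, toReal z ∈ convexHull ℝ (S : Set (Fin 2 → ℝ)) → toReal z ∈ S := by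
    intro z hz
    have hzA := hmem z (hA z (convexHull_mono (by exact_mod_cast hSA) hz))
    refine Finset.mem_filter.2 ⟨hzA, le_antisymm (hle _ hzA) ?_⟩
    have hconv : Convex ℝ {y | c y ≤ f y} := by
      have h1 := (convex_Iic (0 : ℝ)).affine_preimage (dotLift (toReal u) - f)
      have h2 := (convex_Ici (0 : ℝ)).affine_preimage f
      have h3 : {y | c y ≤ f y} = (dotLift (toReal u) - f) ⁻¹' Set.Iic 0 ∩ f ⁻¹' Set.Ici 0 := by
        ext y
        simp [c]
      rw [h3]
      exact Convex.inter h1 h2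
    exact convexHull_min (fun y hy => (Finset.mem_filter.1 hy).2.ge) hconv hz
  obtain ⟨q, hqS, hq, hqe⟩ := (h.mono hSA).exists_empty_basis hxS hSz
  have hqA : ∀ i, ∃ a ∈ A, toReal a = q i := fun i => hmem' _ (hSA (hqS i))
  choose b hbA hb using hqA
  have hfq : ∀ i, f (q i) = ((max (u ⬝ᵥ lift (b i)) 0 : ℤ) : ℝ) := fun i => by
    rw [(Finset.mem_filter.1 (hqS i)).2, ← hb, hcint]
  -- On the empty triangle `q`, `f` has integral vertex values and lattice points have integral
  -- coordinates.
  obtain ⟨v, hv⟩ := exists_int_dotLift f (by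
    intro z
    choose n hn using exists_int_coord_of_empty q (fun i => ⟨_, hb i⟩) hqe z
    refine ⟨∑ i, n i * max (u ⬝ᵥ lift (b i)) 0, ?_⟩
    rw [affineMap_apply_eq_sum q f]
    simp_rw [hfq, hn]
    push_cast
    rfl)
  have hfx : toReal v ⬝ᵥ lift x = ∑ i, q.coord i x * ((max (u ⬝ᵥ lift (b i)) 0 : ℤ) : ℝ) := by
    rw [← hv, affineMap_apply_eq_sum q f]
    simp_rw [hfq]
  have hnn : ∀ i ∈ Finset.univ, 0 ≤ q.coord i x * ((max (u ⬝ᵥ lift (b i)) 0 : ℤ) : ℝ) :=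
    fun i _ => mul_nonneg (hq i).le (by exact_mod_cast le_max_right _ _)
  refine ⟨v, fun a ha => ?_, hfx ▸ Finset.sum_nonneg hnn, fun h0 => ?_⟩
  · have := hle _ (hmem a ha)
    rw [hv, toReal_dotProduct_lift, hcint] at this
    exact_mod_cast this
  · rw [hfx, Finset.sum_eq_zero_iff_of_nonneg hnn] at h0
    have hsub : Set.range q ⊆ toReal '' {a | a ∈ A ∧ u ⬝ᵥ lift a ≤ 0} := by
      rintro _ ⟨i, rfl⟩
      refine ⟨b i, ⟨hbA i, ?_⟩, hb i⟩
      have := (mul_eq_zero.1 (h0 i (Finset.mem_univ i))).resolve_left (hq i).ne'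
      have h2 : max (u ⬝ᵥ lift (b i)) 0 = 0 := by exact_mod_cast this
      exact max_eq_right_iff.1 h2
    refine convexHull_mono hsub ?_
    rw [AffineBasis.convexHull_eq_nonneg_coord]
    exact fun i => (hq i).le

/-! ### Initial ideals -/

section InitialIdeal

variable {k : Type*} [Field k] {m : ℕ} {B : Finset (Fin m → ℤ)}

theorem posMonomial_dvd {u v : Fin m → ℤ} (h : ∀ b ∈ B, v ⬝ᵥ b ≤ max (u ⬝ᵥ b) 0) :
    posMonomial k B v ∣ posMonomial k B u := by
  refine Finset.prod_dvd_prod_of_dvd _ _ fun b _ => pow_dvd_pow _ ?_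
  have := h b.1 b.2
  omega

theorem initialIdeal_smul (w : Fin m → ℝ) {t : ℝ} (ht : 0 < t) :
    initialIdeal k B (t • w) = initialIdeal k B w := by
  have h1 : {u : Fin m → ℤ | 0 < toReal u ⬝ᵥ (t • w)} = {u | 0 < toReal u ⬝ᵥ w} := by
    ext u
    simp [dotProduct_smul, ht]
  have h2 : {u : Fin m → ℤ | toReal u ⬝ᵥ (t • w) = 0} = {u | toReal u ⬝ᵥ w = 0} := by
    ext u
    simp [dotProduct_smul, ht.ne']
  rw [initialIdeal, initialIdeal, h1, h2]

theorem toReal_neg (u : Fin m → ℤ) : toReal (-u) = -toReal u := by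
  ext i
  simp [toReal]

/-- The monomial of `v` divides that of `u`. When `u · w = 0` the hypothesis applies to both `u` and
`-u`, so both terms of the binomial are covered. -/
theorem initialIdeal_le_of_forall {w w' : Fin m → ℝ}
    (h : ∀ u : Fin m → ℤ, u ≠ 0 → 0 ≤ toReal u ⬝ᵥ w →
      ∃ v : Fin m → ℤ, 0 < toReal v ⬝ᵥ w' ∧ ∀ b ∈ B, v ⬝ᵥ b ≤ max (u ⬝ᵥ b) 0) :
    initialIdeal k B w ≤ initialIdeal k B w' := by
  have key : ∀ u : Fin m → ℤ, u ≠ 0 → 0 ≤ toReal u ⬝ᵥ w →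
      posMonomial k B u ∈ initialIdeal k B w' := by
    intro u hu0 hu
    obtain ⟨v, hv, hvu⟩ := h u hu0 hu
    exact Ideal.mem_of_dvd _ (posMonomial_dvd hvu)
      (Ideal.subset_span (Or.inl (Set.mem_image_of_mem _ hv)))
  rw [initialIdeal, Ideal.span_le]
  rintro _ (⟨u, hu, rfl⟩ | ⟨u, hu, rfl⟩)
  · refine key u ?_ (le_of_lt hu)
    rintro rfl
    simp [toReal, dotProduct] at hu
  · by_cases hu0 : u = 0
    · subst hu0
      simp [binomial]
    · refine Ideal.sub_mem _ (key u hu0 (le_of_eq (Eq.symm hu))) (key (-u) (by simpa using hu0) ?_)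
      rw [toReal_neg, neg_dotProduct]
      rw [Set.mem_ofPred_eq] at hu
      simp [hu]

/-- A monomial without variables from a positive representation of `w` is standard for `w`. -/
theorem posMonomial_notMem_initialIdeal {ι : Type*} [Fintype ι] {β : ι → Fin m → ℤ}
    (hβ : ∀ j, β j ∈ B) {c : ι → ℝ} (hc : ∀ j, 0 < c j) {w : Fin m → ℝ}
    (hw : ∑ j, c j • toReal (β j) = w) {u : Fin m → ℤ} (hu : ∀ j, u ⬝ᵥ β j ≤ 0) :
    posMonomial k B u ∉ initialIdeal k B w := by
  classical
  -- Setting the variables of the representation to 0 and the others to 1 kills the initial ideal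
  -- but not the monomial of `u`.
  let φ : MvPolynomial B k →ₐ[k] k :=
    MvPolynomial.aeval fun b : B => if b.1 ∈ Set.range β then 0 else 1
  have hφ : ∀ v : Fin m → ℤ, φ (posMonomial k B v) =
      ∏ b : B, (if b.1 ∈ Set.range β then (0 : k) else 1) ^ (v ⬝ᵥ b.1).toNat := by
    intro v
    simp [posMonomial, φ]
  have h0 : ∀ v : Fin m → ℤ, (∃ j, 0 < v ⬝ᵥ β j) → φ (posMonomial k B v) = 0 := by
    rintro v ⟨j, hj⟩
    rw [hφ]
    refine Finset.prod_eq_zero (Finset.mem_univ (⟨β j, hβ j⟩ : B)) ?_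
    rw [if_pos (Set.mem_range_self j)]
    exact zero_pow (by simp only; omega)
  have h1 : ∀ v : Fin m → ℤ, (∀ j, v ⬝ᵥ β j ≤ 0) → φ (posMonomial k B v) = 1 := by
    intro v hv
    rw [hφ]
    refine Finset.prod_eq_one fun b _ => ?_
    split_ifs with hb
    · obtain ⟨j, hj⟩ := hb
      rw [← hj, Int.toNat_of_nonpos (hv j), pow_zero]
    · exact one_pow _
  have hdot : ∀ v : Fin m → ℤ, toReal v ⬝ᵥ w = ∑ j, c j * ((v ⬝ᵥ β j : ℤ) : ℝ) := by
    intro v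
    rw [← hw, dotProduct_sum]
    simp_rw [dotProduct_smul, toReal_dotProduct, smul_eq_mul]
  have hle : initialIdeal k B w ≤ RingHom.ker φ := by
    rw [initialIdeal, Ideal.span_le]
    rintro _ (⟨v, hv, rfl⟩ | ⟨v, hv, rfl⟩)
    · apply h0
      by_contra! hcon
      rw [Set.mem_ofPred_eq, hdot] at hv
      refine absurd hv (not_lt.2 (Finset.sum_nonpos fun j _ => ?_))
      exact mul_nonpos_of_nonneg_of_nonpos (hc j).le (by exact_mod_cast hcon j)
    · rw [Set.mem_ofPred_eq, hdot] at hv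
      show φ (posMonomial k B v - posMonomial k B (-v)) = 0
      rw [map_sub, sub_eq_zero]
      -- As `v · w = 0`, the numbers `v · β j` either take both signs or all vanish; the two
      -- monomials both map to 0 or both to 1.
      by_cases hp : ∃ j, 0 < v ⬝ᵥ β j
      · rw [h0 v hp, h0 (-v)]
        by_contra! hcon
        simp only [neg_dotProduct, Left.neg_nonpos_iff] at hcon
        obtain ⟨j, hj⟩ := hp
        have : 0 < ∑ j, c j * ((v ⬝ᵥ β j : ℤ) : ℝ) :=
          Finset.sum_pos' (fun i _ => mul_nonneg (hc i).le (by exact_mod_cast hcon i))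
            ⟨j, Finset.mem_univ j, mul_pos (hc j) (by exact_mod_cast hj)⟩
        linarith
      · push Not at hp
        rw [h1 v hp, h1 (-v)]
        by_contra! hcon
        simp only [neg_dotProduct, Left.neg_pos_iff] at hcon
        obtain ⟨j, hj⟩ := hcon
        have : ∑ j, c j * ((v ⬝ᵥ β j : ℤ) : ℝ) < 0 := by
          refine Finset.sum_neg' (fun i _ => mul_nonpos_of_nonneg_of_nonpos (hc i).le
            (by exact_mod_cast hp i)) ⟨j, Finset.mem_univ j, ?_⟩
          exact mul_neg_of_pos_of_neg (hc j) (by exact_mod_cast hj)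
        linarith
  intro hmem
  have := hle hmem
  rw [RingHom.mem_ker, h1 u hu] at this
  exact one_ne_zero this

end InitialIdeal

/-! ### Cones over planar sets -/

/-- The cone over the set `C × {1}`. -/
def coneOver (C : Set (Fin 2 → ℝ)) : Set (Fin 3 → ℝ) :=
  {w | ∃ t : ℝ, 0 ≤ t ∧ ∃ x ∈ C, w = t • lift x}

theorem continuous_lift : Continuous (lift : (Fin 2 → ℝ) → Fin 3 → ℝ) := by
  refine continuous_pi fun i => ?_
  fin_cases i <;> simp only [lift] <;> fun_prop

theorem lift_combination {x y : Fin 2 → ℝ} {a b : ℝ} (hab : a + b = 1) :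
    lift (a • x + b • y) = a • lift x + b • lift y := by
  ext i
  fin_cases i <;> simp [lift, hab]

theorem cone_image_lift {A : Finset (Fin 2 → ℤ)} (hA : A.Nonempty) :
    cone (A.image lift) = coneOver (convexHull ℝ (toReal '' (A : Set (Fin 2 → ℤ)))) := by
  apply Set.Subset.antisymm
  · intro w hw
    refine Submodule.span_induction (p := fun w _ => w ∈ coneOver _) ?_ ?_ ?_ ?_ hw
    · rintro _ ⟨_, hb, rfl⟩
      obtain ⟨a, ha, rfl⟩ := Finset.mem_image.1 (Finset.mem_coe.1 hb)
      exact ⟨1, zero_le_one, toReal a, subset_convexHull _ _ (Set.mem_image_of_mem _ ha),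
        by rw [one_smul, toReal_lift]⟩
    · obtain ⟨a, ha⟩ := hA
      exact ⟨0, le_rfl, toReal a, subset_convexHull _ _ (Set.mem_image_of_mem _ ha), by simp⟩
    · rintro _ _ _ _ ⟨s, hs, x, hx, rfl⟩ ⟨t, ht, y, hy, rfl⟩
      rcases hs.eq_or_lt with rfl | hs
      · exact ⟨t, ht, y, hy, by simp⟩
      have hst : 0 < s + t := by linarith
      refine ⟨s + t, hst.le, (s / (s + t)) • x + (t / (s + t)) • y,
        convex_convexHull _ _ hx hy (by positivity) (by positivity) (by field_simp), ?_⟩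
      rw [lift_combination (by field_simp), smul_add, smul_smul, smul_smul,
        mul_div_cancel₀ _ hst.ne', mul_div_cancel₀ _ hst.ne']
    · rintro ⟨s, hs⟩ _ _ ⟨t, ht, y, hy, rfl⟩
      refine ⟨s * t, mul_nonneg hs ht, y, hy, ?_⟩
      rw [mul_smul]
      rfl
  · rintro _ ⟨t, ht, x, hx, rfl⟩
    have hmem : lift x ∈ PointedCone.hull ℝ (toReal '' ((A.image lift : Finset (Fin 3 → ℤ)) :
        Set (Fin 3 → ℤ))) := by
      have hconv : Convex ℝ {x | lift x ∈ PointedCone.hull ℝ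
          (toReal '' ((A.image lift : Finset (Fin 3 → ℤ)) : Set (Fin 3 → ℤ)))} := by
        intro x hx y hy a b ha hb hab
        rw [Set.mem_ofPred_eq, lift_combination hab]
        exact add_mem (PointedCone.smul_mem _ ha hx) (PointedCone.smul_mem _ hb hy)
      refine convexHull_min ?_ hconv hx
      rintro _ ⟨a, ha, rfl⟩
      rw [Set.mem_ofPred_eq, ← toReal_lift]
      exact Submodule.subset_span (Set.mem_image_of_mem _ (by simpa using ⟨a, ha, rfl⟩))
    exact PointedCone.smul_mem _ ht hmem

theorem lift_two (x : Fin 2 → ℝ) : lift x 2 = 1 := rfl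

/-- The scalar `t` is the last coordinate, so up to any bounded height the cone lies in a compact
image. -/
theorem isClosed_coneOver {C : Set (Fin 2 → ℝ)} (hC : IsCompact C) : IsClosed (coneOver C) := by
  refine isClosed_of_closure_subset fun w hw => ?_
  have hopen : IsOpen {v : Fin 3 → ℝ | v 2 < w 2 + 1} :=
    isOpen_lt (continuous_apply 2) continuous_const
  have h1 := hopen.inter_closure (t := coneOver C) ⟨(lt_add_one (w 2) : w 2 < w 2 + 1), hw⟩
  have hK : IsCompact ((fun q : ℝ × (Fin 2 → ℝ) => q.1 • lift q.2) ''
      (Set.Icc 0 (w 2 + 1) ×ˢ C)) :=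
    (isCompact_Icc.prod hC).image (continuous_fst.smul (continuous_lift.comp continuous_snd))
  have h2 : {v : Fin 3 → ℝ | v 2 < w 2 + 1} ∩ coneOver C ⊆
      (fun q : ℝ × (Fin 2 → ℝ) => q.1 • lift q.2) '' (Set.Icc 0 (w 2 + 1) ×ˢ C) := by
    rintro _ ⟨hv, t, ht, x, hx, rfl⟩
    refine ⟨(t, x), ⟨⟨ht, ?_⟩, hx⟩, rfl⟩
    simp only [Set.mem_ofPred_eq, Pi.smul_apply, lift_two, smul_eq_mul, mul_one] at hv
    exact hv.le
  obtain ⟨⟨t, x⟩, ⟨ht, hx⟩, rfl⟩ := closure_minimal h2 hK.isClosed h1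
  exact ⟨t, ht.1, x, hx, rfl⟩

theorem coneOver_subset_closure {C : Set (Fin 2 → ℝ)} {S : Set (Fin 3 → ℝ)}
    (hC : C ⊆ closure (interior C)) (h : ∀ t : ℝ, 0 < t → ∀ x ∈ interior C, t • lift x ∈ S) :
    coneOver C ⊆ closure S := by
  rintro _ ⟨t, ht, x, hx, rfl⟩
  have hcont : Continuous fun q : ℝ × (Fin 2 → ℝ) => q.1 • lift q.2 :=
    continuous_fst.smul (continuous_lift.comp continuous_snd)
  have hmem : (t, x) ∈ closure (Set.Ioi (0 : ℝ) ×ˢ interior C) := by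
    rw [closure_prod_eq, closure_Ioi]
    exact ⟨ht, hC hx⟩
  have := image_closure_subset_closure_image hcont (Set.mem_image_of_mem _ hmem)
  refine closure_mono ?_ this
  rintro _ ⟨⟨s, y⟩, ⟨hs, hy⟩, rfl⟩
  exact h s hs y hy

/-! ### The Gröbner cone of a region -/

/-- An integral multiple of a barycentric coordinate of a lattice triangle. -/
theorem exists_int_coord_multiple (p : AffineBasis (Fin 3) ℝ (Fin 2 → ℝ)) {q : Fin 3 → Fin 2 → ℤ}
    (hq : ∀ i, toReal (q i) = p i) (i : Fin 3) :
    ∃ (u : Fin 3 → ℤ) (N : ℝ), 0 < N ∧ ∀ y, toReal u ⬝ᵥ lift y = N * p.coord i y := by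
  -- The cross product is orthogonal to the lifts of the two vertices other than `q i`.
  let u := crossProduct (lift (q (i + 1))) (lift (q (i + 2)))
  let D := u ⬝ᵥ lift (q i)
  have h1 : ∀ j, u ⬝ᵥ lift (q j) = if j = i then D else 0 := by
    intro j
    rcases (by decide : ∀ i j : Fin 3, j = i ∨ j = i + 1 ∨ j = i + 2) i j with rfl | rfl | rfl
    · simp [D]
    · rw [if_neg ((by decide : ∀ i : Fin 3, i + 1 ≠ i) i), dotProduct_comm]
      exact dot_self_cross _ _
    · rw [if_neg ((by decide : ∀ i : Fin 3, i + 2 ≠ i) i), dotProduct_comm]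
      exact dot_cross_self _ _
  have h2 : ∀ y, dotLift (toReal u) y = D * p.coord i y := by
    intro y
    rw [affineMap_apply_eq_sum p]
    simp_rw [dotLift_apply, ← hq, toReal_dotProduct_lift, h1]
    simp [mul_comm]
  have hD : D ≠ 0 := by
    intro h0
    have e1 := h2 (toReal 0)
    have e2 := h2 (toReal (Pi.single 0 1))
    have e3 := h2 (toReal (Pi.single 1 1))
    rw [h0, dotLift_apply, toReal_dotProduct_lift] at e1 e2 e3
    simp [u, lift, crossProduct, dotProduct, Fin.sum_univ_three] at e1 e2 e3
    rw [e1] at e2 e3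
    have hinj : q (i + 1) = q (i + 2) := by
      ext j
      fin_cases j
      · have : (q (i + 2) 0 : ℝ) = q (i + 1) 0 := by linarith
        exact_mod_cast this.symm
      · have : (q (i + 2) 1 : ℝ) = q (i + 1) 1 := by linarith
        exact_mod_cast this.symm
    exact (by decide : ∀ i : Fin 3, i + 1 ≠ i + 2) i
      (p.ind.injective ((hq _).symm.trans ((congrArg toReal hinj).trans (hq _))))
  -- The sign of `D` is unknown; a further factor `D` makes the multiple positive.
  refine ⟨D • u, (D : ℝ) ^ 2, by positivity, fun y => ?_⟩
  have : toReal (D • u) = (D : ℝ) • toReal u := by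
    ext j
    simp [toReal]
  rw [this, smul_dotProduct, ← dotLift_apply, h2, smul_eq_mul]
  ring

theorem lift_eq_sum {p : AffineBasis (Fin 3) ℝ (Fin 2 → ℝ)} {q : Fin 3 → Fin 2 → ℤ}
    (hq : ∀ i, toReal (q i) = p i) (x : Fin 2 → ℝ) :
    ∑ i, p.coord i x • toReal (lift (q i)) = lift x := by
  have h1 := p.sum_coord_apply_eq_one x
  have h2 := p.linear_combination_coord_eq_self x
  rw [Fin.sum_univ_three] at h1 h2 ⊢
  simp_rw [toReal_lift, hq]
  have e0 := congrFun h2 0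
  have e1 := congrFun h2 1
  ext j
  fin_cases j
  · simpa [lift] using e0
  · simpa [lift] using e1
  · simpa [lift] using h1

section Region

variable {k : Type*} [Field k] {R : Set (Fin 2 → ℝ)} {A : Finset (Fin 2 → ℤ)}

theorem IsRegion.initialIdeal_le
    (hR : IsRegion (convexHull ℝ (toReal '' (A : Set (Fin 2 → ℤ)))) R)
    (hA : ∀ z, toReal z ∈ convexHull ℝ (toReal '' (A : Set (Fin 2 → ℤ))) → z ∈ A)
    {r r' : Fin 2 → ℝ} (hr : r ∈ interior R) (hr' : r' ∈ interior R) :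
    initialIdeal k (A.image lift) (lift r) ≤ initialIdeal k (A.image lift) (lift r') := by
  classical
  obtain ⟨AR, hAR⟩ : ∃ AR : Finset (Fin 2 → ℝ), (AR : Set (Fin 2 → ℝ)) = toReal '' A :=
    ⟨A.image toReal, by simp⟩
  rw [← hAR] at hR hA
  have hlat : ∀ a ∈ AR, a ∈ Set.range toReal := fun a ha => by
    rw [← Finset.mem_coe, hAR] at ha
    exact Set.image_subset_range _ _ ha
  refine initialIdeal_le_of_forall fun u hu0 hu => ?_
  obtain ⟨v, hvA, hv0, hv⟩ := exists_integral_minorant hAR hA (hR.generic rfl hlat hr')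
    (hR.subset (interior_subset hr')) u
  refine ⟨v, lt_of_le_of_ne hv0 fun h0 => hu0 ?_, fun b hb => ?_⟩
  -- Value zero puts `r'`, hence `r`, in the hull of the points with `u ≤ 0`. Since `u` is
  -- nonnegative at `r`, it vanishes on a triangle around `r`, so `u = 0`.
  · have hmem := hv h0.symm
    let D := AR.filter fun y => dotLift (toReal u) y ≤ 0
    have hD : (D : Set (Fin 2 → ℝ)) = toReal '' {a | a ∈ A ∧ u ⬝ᵥ lift a ≤ 0} := by
      ext y
      simp only [D, Finset.coe_filter, ← Finset.mem_coe, hAR, Set.mem_ofPred_eq]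
      constructor
      · rintro ⟨⟨a, ha, rfl⟩, h⟩
        rw [dotLift_apply, toReal_dotProduct_lift] at h
        exact ⟨a, ⟨ha, by exact_mod_cast h⟩, rfl⟩
      · rintro ⟨a, ⟨ha, h⟩, rfl⟩
        refine ⟨⟨a, ha, rfl⟩, ?_⟩
        rw [dotLift_apply, toReal_dotProduct_lift]
        exact_mod_cast h
    have hDA : D ⊆ AR := Finset.filter_subset _ _
    rw [← hD] at hmem
    have hrD := hR.mem_convexHull_of_mem rfl hlat hr' (interior_subset hr) hDA hmem
    obtain ⟨p, hpD, hp⟩ := ((hR.generic rfl hlat hr).mono hDA).exists_basis hrD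
    have hle : ∀ i ∈ Finset.univ, p.coord i r * dotLift (toReal u) (p i) ≤ 0 := fun i _ =>
      mul_nonpos_of_nonneg_of_nonpos (hp i).le (Finset.mem_filter.1 (hpD i)).2
    have hsum : ∑ i, p.coord i r * dotLift (toReal u) (p i) = 0 := by
      refine le_antisymm (Finset.sum_nonpos hle) ?_
      rw [← affineMap_apply_eq_sum]
      exact hu
    have hz := (Finset.sum_eq_zero_iff_of_nonpos hle).1 hsum
    have hall : ∀ y, dotLift (toReal u) y = 0 := by
      intro y
      rw [affineMap_apply_eq_sum p]
      refine Finset.sum_eq_zero fun i hi => ?_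
      rw [(mul_eq_zero.1 (hz i hi)).resolve_left (hp i).ne', mul_zero]
    have e1 := hall (toReal 0)
    have e2 := hall (toReal (Pi.single 0 1))
    have e3 := hall (toReal (Pi.single 1 1))
    rw [dotLift_apply, toReal_dotProduct_lift] at e1 e2 e3
    simp [lift, dotProduct, Fin.sum_univ_three] at e1 e2 e3
    rw [e1] at e2 e3
    ext i
    fin_cases i
    · simpa using e2
    · simpa using e3
    · exact e1
  · obtain ⟨a, ha, rfl⟩ := Finset.mem_image.1 hb
    exact hvA a ha

/-- If `x` is outside a triangle that contains `R`, some coordinate is negative at `x`. Let `u` be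
an integral multiple of it: `-u` is positive at `x` but nonpositive at the vertices, which represent
`r` positively, so its monomial separates the two initial ideals. -/
theorem IsRegion.groebnerCell_subset
    (hR : IsRegion (convexHull ℝ (toReal '' (A : Set (Fin 2 → ℤ)))) R)
    (hA : ∀ z, toReal z ∈ convexHull ℝ (toReal '' (A : Set (Fin 2 → ℤ))) → z ∈ A)
    {r : Fin 2 → ℝ} (hr : r ∈ interior R) :
    groebnerCell k (A.image lift) (lift r) ⊆ coneOver R := by
  classical
  have hne : A.Nonempty := by
    have := hR.subset (interior_subset hr)
    rw [← Finset.coe_nonempty, ← Set.image_nonempty (f := toReal),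
      ← convexHull_nonempty_iff (𝕜 := ℝ)]
    exact ⟨r, this⟩
  obtain ⟨AR, hAR⟩ : ∃ AR : Finset (Fin 2 → ℝ), (AR : Set (Fin 2 → ℝ)) = toReal '' A :=
    ⟨A.image toReal, by simp⟩
  rintro w ⟨hw, hin⟩
  rw [cone_image_lift hne] at hw
  rw [← hAR] at hR hA hw
  have hlat : ∀ a ∈ AR, a ∈ Set.range toReal := fun a ha => by
    rw [← Finset.mem_coe, hAR] at ha
    exact Set.image_subset_range _ _ ha
  have hPA : ∀ a ∈ convexHull ℝ (AR : Set (Fin 2 → ℝ)), a ∈ Set.range toReal → a ∈ AR := by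
    rintro _ ha ⟨z, rfl⟩
    rw [← Finset.mem_coe, hAR]
    exact Set.mem_image_of_mem _ (hA z ha)
  obtain ⟨t, ht, x, hx, rfl⟩ := hw
  rcases ht.eq_or_lt with rfl | ht
  · exact ⟨0, le_rfl, r, interior_subset hr, by simp⟩
  refine ⟨t, ht.le, x, hR.mem_of_forall rfl hlat hPA fun p hpA hRp => ?_, rfl⟩
  rw [AffineBasis.convexHull_eq_nonneg_coord]
  intro i
  by_contra! hneg
  have hpA' : ∀ i, ∃ a ∈ A, toReal a = p i := fun i => by
    have := hpA i
    rw [← Finset.mem_coe, hAR] at this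
    exact this
  choose q hqA hq using hpA'
  obtain ⟨u, N, hN, hu⟩ := exists_int_coord_multiple p hq i
  have hrp := interior_mono hRp hr
  rw [AffineBasis.interior_convexHull] at hrp
  have hnot := posMonomial_notMem_initialIdeal (k := k) (B := A.image lift)
    (β := fun j => lift (q j)) (fun j => Finset.mem_image_of_mem _ (hqA j))
    (c := fun j => p.coord j r) hrp (lift_eq_sum hq r) (u := -u) (by
      intro j
      have h1 := hu (toReal (q j))
      rw [toReal_dotProduct_lift, hq, AffineBasis.coord_apply] at h1
      have h2 : (0 : ℝ) ≤ ((u ⬝ᵥ lift (q j) : ℤ) : ℝ) := by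
        rw [h1]
        split_ifs <;> simp [hN.le]
      rw [neg_dotProduct]
      have h3 : 0 ≤ u ⬝ᵥ lift (q j) := by exact_mod_cast h2
      omega)
  apply hnot
  rw [← hin, initialIdeal_smul _ ht]
  refine Ideal.subset_span (Or.inl (Set.mem_image_of_mem _ ?_))
  rw [Set.mem_ofPred_eq, toReal_neg, neg_dotProduct, hu]
  nlinarith

theorem IsRegion.closure_groebnerCell
    (hR : IsRegion (convexHull ℝ (toReal '' (A : Set (Fin 2 → ℤ)))) R)
    (hA : ∀ z, toReal z ∈ convexHull ℝ (toReal '' (A : Set (Fin 2 → ℤ))) → z ∈ A)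
    {r : Fin 2 → ℝ} (hr : r ∈ interior R) :
    lift r ∈ cone (A.image lift) ∧
      closure (groebnerCell k (A.image lift) (lift r)) = coneOver R := by
  have hne : A.Nonempty := by
    have := hR.subset (interior_subset hr)
    rw [← Finset.coe_nonempty, ← Set.image_nonempty (f := toReal),
      ← convexHull_nonempty_iff (𝕜 := ℝ)]
    exact ⟨r, this⟩
  have hcomp : IsCompact (convexHull ℝ (toReal '' (A : Set (Fin 2 → ℤ)))) :=
    (A.finite_toSet.image _).isCompact_convexHull ℝ
  have hRc : IsCompact R := hcomp.of_isClosed_subset (hR.isClosed hcomp.isClosed) hR.subset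
  have hmem : ∀ t : ℝ, 0 < t → ∀ x ∈ interior R,
      t • lift x ∈ groebnerCell k (A.image lift) (lift r) := by
    intro t ht x hx
    refine ⟨?_, ?_⟩
    · rw [cone_image_lift hne]
      exact ⟨t, ht.le, x, hR.subset (interior_subset hx), rfl⟩
    · rw [initialIdeal_smul _ ht]
      exact le_antisymm (hR.initialIdeal_le hA hx hr) (hR.initialIdeal_le hA hr hx)
  refine ⟨?_, Set.Subset.antisymm (closure_minimal (hR.groebnerCell_subset hA hr)
    (isClosed_coneOver hRc)) (coneOver_subset_closure ?_ hmem)⟩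
  · rw [cone_image_lift hne]
    exact ⟨1, zero_le_one, r, hR.subset (interior_subset hr), by simp⟩
  · rw [(hR.convex (convex_convexHull _ _)).closure_interior_eq_closure_of_nonempty_interior ⟨r, hr⟩]
    exact subset_closure

end Region

/-! ### Facets of cones over planar sets -/

/-- The linear embedding of the plane at height zero. -/
def embedZero : (Fin 2 → ℝ) →ₗ[ℝ] Fin 3 → ℝ where
  toFun y := ![y 0, y 1, 0]
  map_add' x y := by ext i; fin_cases i <;> simp
  map_smul' c x := by ext i; fin_cases i <;> simp

theorem embedZero_injective : Function.Injective embedZero := by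
  intro x y h
  have h0 := congrFun h 0
  have h1 := congrFun h 1
  simp only [embedZero, LinearMap.coe_mk, AddHom.coe_mk, Matrix.cons_val] at h0 h1
  ext i
  fin_cases i
  exacts [h0, h1]

theorem embedZero_sub (x y : Fin 2 → ℝ) : embedZero (x - y) = lift x - lift y := by
  ext i
  fin_cases i <;> simp [embedZero, lift]

theorem zero_mem_coneOver {C : Set (Fin 2 → ℝ)} (hC : C.Nonempty) : (0 : Fin 3 → ℝ) ∈ coneOver C := by
  obtain ⟨x, hx⟩ := hC
  exact ⟨0, le_rfl, x, hx, by simp⟩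

theorem lift_mem_coneOver {C : Set (Fin 2 → ℝ)} {x : Fin 2 → ℝ} :
    lift x ∈ coneOver C ↔ x ∈ C := by
  constructor
  · rintro ⟨t, -, y, hy, h⟩
    have ht : t = 1 := by
      have := congrFun h 2
      simp only [Pi.smul_apply, lift_two, smul_eq_mul, mul_one] at this
      exact this.symm
    have hxy : x = y := by
      have := embedZero_sub x y
      rw [h, ht, one_smul, sub_self] at this
      rw [← sub_eq_zero]
      exact embedZero_injective (this.trans (map_zero _).symm)
    rwa [hxy]
  · exact fun hx => ⟨1, zero_le_one, x, hx, by simp⟩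

theorem coneOver_injective : Function.Injective coneOver := by
  intro C D h
  ext x
  rw [← lift_mem_coneOver, h, lift_mem_coneOver]

theorem finrank_vectorSpan_coneOver {C : Set (Fin 2 → ℝ)} (hC : C.Nonempty) :
    Module.finrank ℝ (vectorSpan ℝ (coneOver C)) = Module.finrank ℝ (vectorSpan ℝ C) + 1 := by
  obtain ⟨x₀, hx₀⟩ := hC
  have h0 := zero_mem_coneOver ⟨x₀, hx₀⟩
  have hspan : vectorSpan ℝ (coneOver C) =
      (vectorSpan ℝ C).map embedZero ⊔ Submodule.span ℝ {lift x₀} := by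
    rw [vectorSpan_eq_span_vsub_set_right ℝ h0, vectorSpan_eq_span_vsub_set_right ℝ hx₀]
    simp only [vsub_eq_sub, sub_zero, Set.image_id']
    apply le_antisymm
    · rw [Submodule.span_le]
      rintro _ ⟨t, -, x, hx, rfl⟩
      refine Submodule.smul_mem _ _ ?_
      rw [← sub_add_cancel (lift x) (lift x₀), ← embedZero_sub]
      exact Submodule.add_mem_sup (Submodule.mem_map_of_mem
        (Submodule.subset_span (Set.mem_image_of_mem _ hx))) (Submodule.mem_span_singleton_self _)
    · have hl : ∀ x ∈ C, lift x ∈ Submodule.span ℝ (coneOver C) := fun x hx =>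
        Submodule.subset_span (lift_mem_coneOver.2 hx)
      refine sup_le ?_ ?_
      · rw [Submodule.map_span_le]
        rintro _ ⟨x, hx, rfl⟩
        rw [embedZero_sub]
        exact Submodule.sub_mem _ (hl x hx) (hl x₀ hx₀)
      · rw [Submodule.span_singleton_le_iff_mem]
        exact hl x₀ hx₀
  have hinf : (vectorSpan ℝ C).map embedZero ⊓ Submodule.span ℝ {lift x₀} = ⊥ := by
    rw [eq_bot_iff]
    rintro _ ⟨⟨y, -, rfl⟩, hy⟩
    obtain ⟨c, hc⟩ := Submodule.mem_span_singleton.1 hy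
    have h2 := congrFun hc 2
    simp only [Pi.smul_apply, lift_two, smul_eq_mul, mul_one, embedZero, LinearMap.coe_mk,
      AddHom.coe_mk, Matrix.cons_val] at h2
    rw [Submodule.mem_bot, ← hc, h2, zero_smul]
  have hne : lift x₀ ≠ 0 := fun h => by
    have := congrFun h 2
    simp [lift_two] at this
  have := Submodule.finrank_sup_add_finrank_inf_eq ((vectorSpan ℝ C).map embedZero)
    (Submodule.span ℝ {lift x₀})
  rw [hinf, finrank_bot, add_zero, finrank_span_singleton hne] at this
  rw [hspan, this, (Submodule.equivMapOfInjective _ embedZero_injective _).finrank_eq]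

/-- A functional `l` that is maximal on `F`, with value `l x₀`, is homogenised to `l x - l x₀ *
height`, which is nonpositive on the cone and zero exactly over `F`. -/
theorem IsExposed.coneOver {C F : Set (Fin 2 → ℝ)} (hF : IsExposed ℝ C F) (hne : F.Nonempty) :
    IsExposed ℝ (coneOver C) (coneOver F) := by
  intro _
  obtain ⟨l, hl⟩ := hF hne
  obtain ⟨x₀, hx₀⟩ := hne
  have hx₀' := hx₀
  rw [hl] at hx₀'
  obtain ⟨hx₀C, hmax⟩ := hx₀'
  let L₀ : (Fin 3 → ℝ) →ₗ[ℝ] ℝ :=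
    (l : (Fin 2 → ℝ) →ₗ[ℝ] ℝ) ∘ₗ LinearMap.pi ![LinearMap.proj 0, LinearMap.proj 1] -
      l x₀ • LinearMap.proj 2
  have hL₀ : ∀ (t : ℝ) (x : Fin 2 → ℝ), L₀ (t • lift x) = t * (l x - l x₀) := by
    intro t x
    have hx : (fun i => (![LinearMap.proj 0, LinearMap.proj 1] :
        Fin 2 → (Fin 3 → ℝ) →ₗ[ℝ] ℝ) i (lift x)) = x := by
      ext i
      fin_cases i <;> simp [lift]
    rw [map_smul, smul_eq_mul]
    congr 1
    simp only [L₀, LinearMap.sub_apply, LinearMap.comp_apply, LinearMap.smul_apply,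
      LinearMap.proj_apply, lift_two, smul_eq_mul, mul_one]
    congr 1
    exact congrArg l hx
  refine ⟨L₀.toContinuousLinearMap, ?_⟩
  ext w
  simp only [Set.mem_ofPred_eq, LinearMap.coe_toContinuousLinearMap']
  constructor
  · rintro ⟨t, ht, x, hx, rfl⟩
    rw [hl] at hx
    refine ⟨⟨t, ht, x, hx.1, rfl⟩, ?_⟩
    rintro _ ⟨s, hs, y, hy, rfl⟩
    rw [hL₀, hL₀, le_antisymm (hmax x hx.1) (hx.2 x₀ hx₀C), sub_self, mul_zero]
    exact mul_nonpos_of_nonneg_of_nonpos hs (sub_nonpos.2 (hmax y hy))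
  · rintro ⟨⟨t, ht, x, hx, rfl⟩, h⟩
    rcases ht.eq_or_lt with rfl | ht
    · exact ⟨0, le_rfl, x₀, hx₀, by simp⟩
    refine ⟨t, ht.le, x, ?_, rfl⟩
    have h1 := h 0 (zero_mem_coneOver ⟨x₀, hx₀C⟩)
    rw [map_zero, hL₀] at h1
    have h2 : l x₀ ≤ l x := by
      have := nonneg_of_mul_nonneg_right h1 ht
      linarith
    rw [hl]
    exact ⟨hx, fun y hy => (hmax y hy).trans h2⟩

theorem encard_facets_le_coneOver {C : Set (Fin 2 → ℝ)} :
    (facets C).encard ≤ (facets (coneOver C)).encard := by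
  refine Set.encard_le_encard_of_injOn (f := coneOver) ?_ coneOver_injective.injOn
  rintro F ⟨hne, hF, hrank⟩
  have hC : C.Nonempty := hne.mono hF.subset
  exact ⟨⟨_, zero_mem_coneOver hne⟩, IsExposed.coneOver hF hne, by
    rw [finrank_vectorSpan_coneOver hne, finrank_vectorSpan_coneOver hC, hrank]⟩

/-! ### The codimension of the lattice ideal -/

section ToricMap

variable {k : Type*} [Field k] {σ G H : Type*} [AddCommGroup G] [AddCommGroup H]

/-- The algebra map that sends a monomial to the class of its exponent vector under `π`. -/
noncomputable def toricMap (k : Type*) [Field k] (π : (σ → ℤ) →+ G) :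
    MvPolynomial σ k →ₐ[k] AddMonoidAlgebra k G :=
  letI := Classical.decEq σ
  MvPolynomial.aeval fun b => AddMonoidAlgebra.single (π (Pi.single b 1)) 1

theorem toricMap_monomial [Fintype σ] (π : (σ → ℤ) →+ G) (d : σ →₀ ℕ) (c : k) :
    toricMap k π (MvPolynomial.monomial d c) =
      AddMonoidAlgebra.single (π fun b => (d b : ℤ)) c := by
  classical
  have hprod : ∀ s : Finset σ, ∏ b ∈ s, AddMonoidAlgebra.single (π (Pi.single b 1)) (1 : k) ^ d b =
      AddMonoidAlgebra.single (∑ b ∈ s, d b • π (Pi.single b 1)) 1 := by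
    intro s
    induction s using Finset.induction_on with
    | empty => simp [AddMonoidAlgebra.one_def]
    | insert a s ha ih =>
      rw [Finset.prod_insert ha, Finset.sum_insert ha, ih, AddMonoidAlgebra.single_pow,
        AddMonoidAlgebra.single_mul_single]
      simp
  have hsum : ∑ b, d b • π (Pi.single b 1) = π fun b => (d b : ℤ) := by
    rw [← Finset.univ_sum_single fun b => (d b : ℤ), map_sum]
    refine Finset.sum_congr rfl fun b _ => ?_
    rw [← map_nsmul]
    congr 1
    ext i
    by_cases h : i = b
    · subst h; simp
    · simp [h]
  rw [toricMap, MvPolynomial.aeval_monomial, Finsupp.prod_fintype _ _ (by simp)]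
  have := hprod Finset.univ
  rw [hsum] at this
  convert! congrArg (algebraMap k (AddMonoidAlgebra k G) c * ·) this using 1
  simp [AddMonoidAlgebra.single_mul_single]

theorem ker_toricMap_le_ker_comp (π : (σ → ℤ) →+ G) (ρ : G →+ H) :
    RingHom.ker (toricMap k π) ≤ RingHom.ker (toricMap k (ρ.comp π)) := by
  have h : toricMap k (ρ.comp π) = (AddMonoidAlgebra.mapDomainAlgHom k k ρ).comp (toricMap k π) := by
    apply MvPolynomial.algHom_ext
    intro b
    simp [toricMap, AddMonoidAlgebra.mapDomain_single]
  intro f hf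
  rw [RingHom.mem_ker] at hf ⊢
  rw [h, AlgHom.comp_apply, hf, map_zero]

/-- An ideal that contains the differences of monomials of equal degree contains the kernel. -/
theorem ker_toricMap_le [Fintype σ] (π : (σ → ℤ) →+ G) (I : Ideal (MvPolynomial σ k))
    (hI : ∀ d d' : σ →₀ ℕ, (π fun b => (d b : ℤ)) = (π fun b => (d' b : ℤ)) →
      MvPolynomial.monomial d (1 : k) - MvPolynomial.monomial d' 1 ∈ I) :
    RingHom.ker (toricMap k π) ≤ I := by
  classical
  -- One monomial is chosen in each degree. Modulo `I` the choice is immaterial, so the quotient map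
  -- factors through `toricMap`.
  let s : G → MvPolynomial σ k := fun g =>
    if h : ∃ d : σ →₀ ℕ, (π fun b => (d b : ℤ)) = g then MvPolynomial.monomial h.choose 1 else 0
  let Θ : AddMonoidAlgebra k G →ₗ[k] (MvPolynomial σ k ⧸ I) :=
    (Finsupp.linearCombination k fun g => Ideal.Quotient.mkₐ k I (s g)) ∘ₗ
      (AddMonoidAlgebra.coeffLinearEquiv k).toLinearMap
  have hΘ : Θ ∘ₗ (toricMap k π).toLinearMap = (Ideal.Quotient.mkₐ k I).toLinearMap := by
    apply MvPolynomial.linearMap_ext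
    intro d
    apply LinearMap.ext_ring
    have hd : ∃ d' : σ →₀ ℕ, (π fun b => (d' b : ℤ)) = π fun b => (d b : ℤ) := ⟨d, rfl⟩
    have hs : s (π fun b => (d b : ℤ)) = MvPolynomial.monomial hd.choose 1 := dif_pos hd
    simp only [LinearMap.comp_apply, AlgHom.toLinearMap_apply, toricMap_monomial, Θ,
      LinearEquiv.coe_coe]
    have hc : AddMonoidAlgebra.coeffLinearEquiv k
        (AddMonoidAlgebra.single (π fun b => (d b : ℤ)) (1 : k)) = Finsupp.single _ 1 := rfl
    rw [hc, Finsupp.linearCombination_single, one_smul, hs]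
    exact Ideal.Quotient.eq.2 (hI _ _ hd.choose_spec)
  intro f hf
  rw [RingHom.mem_ker] at hf
  have := LinearMap.congr_fun hΘ f
  simp only [LinearMap.comp_apply, AlgHom.toLinearMap_apply, hf, map_zero] at this
  exact Ideal.Quotient.eq_zero_iff_mem.1 this.symm

end ToricMap

section Height

variable {k : Type*} [Field k] {m : ℕ} {B : Finset (Fin m → ℤ)}

/-- The vector of all `u · b`. -/
def pairing (B : Finset (Fin m → ℤ)) : (Fin m → ℤ) →+ (B → ℤ) where
  toFun u b := u ⬝ᵥ b.1
  map_zero' := by ext; simp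
  map_add' u v := by ext; simp [add_dotProduct]

theorem pairing_apply (u : Fin m → ℤ) (b : B) : pairing B u b = u ⬝ᵥ b.1 := rfl

/-- The exponent vector of `posMonomial`. -/
noncomputable def posExponent (B : Finset (Fin m → ℤ)) (u : Fin m → ℤ) : B →₀ ℕ :=
  Finsupp.equivFunOnFinite.symm fun b => (u ⬝ᵥ b.1).toNat

theorem posExponent_apply (u : Fin m → ℤ) (b : B) : posExponent B u b = (u ⬝ᵥ b.1).toNat := rfl

theorem posMonomial_eq_monomial (u : Fin m → ℤ) :
    posMonomial k B u = MvPolynomial.monomial (posExponent B u) 1 := by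
  rw [MvPolynomial.monomial_eq, Finsupp.prod_fintype _ _ (by simp)]
  simp [posMonomial, posExponent_apply]

theorem toricMap_binomial {G : Type*} [AddCommGroup G] (π : (B → ℤ) →+ G) (u : Fin m → ℤ) :
    toricMap k π (binomial k B u) = 0 ↔ π (pairing B u) = 0 := by
  have h : pairing B u =
      (fun b => (posExponent B u b : ℤ)) - fun b => (posExponent B (-u) b : ℤ) := by
    ext b
    simp only [pairing_apply, posExponent_apply, Pi.sub_apply, neg_dotProduct]
    omega
  rw [binomial, map_sub, posMonomial_eq_monomial, posMonomial_eq_monomial, toricMap_monomial,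
    toricMap_monomial, sub_eq_zero, h, map_sub, sub_eq_zero]
  exact (AddMonoidAlgebra.single_left_injective one_ne_zero).eq_iff

theorem monomial_sub_mem_latticeIdeal {d d' : B →₀ ℕ} {u : Fin m → ℤ}
    (h : ∀ b, (d b : ℤ) - d' b = u ⬝ᵥ b.1) :
    MvPolynomial.monomial d (1 : k) - MvPolynomial.monomial d' 1 ∈ latticeIdeal k B := by
  have h1 : d = d ⊓ d' + posExponent B u := by
    ext b
    have := h b
    rw [Finsupp.add_apply, Finsupp.inf_apply, posExponent_apply]
    omega
  have h2 : d' = d ⊓ d' + posExponent B (-u) := by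
    ext b
    have := h b
    rw [Finsupp.add_apply, Finsupp.inf_apply, posExponent_apply, neg_dotProduct]
    omega
  have h3 : MvPolynomial.monomial d (1 : k) - MvPolynomial.monomial d' 1 =
      MvPolynomial.monomial (d ⊓ d') 1 * binomial k B u := by
    rw [binomial, posMonomial_eq_monomial, posMonomial_eq_monomial, mul_sub,
      MvPolynomial.monomial_mul, MvPolynomial.monomial_mul, ← h1, ← h2, one_mul]
  rw [h3]
  exact Ideal.mul_mem_left _ _ (Ideal.subset_span (Set.mem_range_self u))

/-- If a prime ideal contains no variables, the vectors whose binomial it contains form a group. -/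
theorem exists_addSubgroup_binomial_mem (q : Ideal (MvPolynomial B k)) [hq : q.IsPrime]
    (hX : ∀ b, MvPolynomial.X b ∉ q) :
    ∃ L : AddSubgroup (Fin m → ℤ), ∀ u, u ∈ L ↔ binomial k B u ∈ q := by
  let F := FractionRing (MvPolynomial B k ⧸ q)
  let φ : MvPolynomial B k →+* F := (algebraMap _ F).comp (Ideal.Quotient.mk q)
  have hφ : ∀ f, φ f = 0 ↔ f ∈ q := by
    intro f
    rw [← Ideal.Quotient.eq_zero_iff_mem]
    exact map_eq_zero_iff _ (IsFractionRing.injective (MvPolynomial B k ⧸ q) F)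
  have hne : ∀ b : B, φ (MvPolynomial.X b) ≠ 0 := fun b h => hX b ((hφ _).1 h)
  -- In the fraction field of the quotient the variables are units, so `χ` is a character of `ℤ^m`,
  -- and the wanted group is its kernel.
  let χ : (Fin m → ℤ) → F := fun u => ∏ b : B, φ (MvPolynomial.X b) ^ (u ⬝ᵥ b.1)
  have hχne : ∀ u, χ u ≠ 0 := fun u => Finset.prod_ne_zero_iff.2 fun b _ => zpow_ne_zero _ (hne b)
  have hadd : ∀ u v, χ (u + v) = χ u * χ v := by
    intro u v
    simp only [χ, add_dotProduct]
    rw [← Finset.prod_mul_distrib]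
    exact Finset.prod_congr rfl fun b _ => zpow_add₀ (hne b) _ _
  have hzero : χ 0 = 1 := by simp [χ]
  have hbin : ∀ u, χ u = 1 ↔ binomial k B u ∈ q := by
    intro u
    have h1 : χ u * φ (posMonomial k B (-u)) = φ (posMonomial k B u) := by
      simp only [χ, posMonomial, map_prod, map_pow]
      rw [← Finset.prod_mul_distrib]
      refine Finset.prod_congr rfl fun b _ => ?_
      rw [← zpow_natCast, ← zpow_natCast, ← zpow_add₀ (hne b), neg_dotProduct]
      congr 1
      omega
    have h2 : φ (posMonomial k B (-u)) ≠ 0 := by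
      simp only [posMonomial, map_prod, map_pow]
      exact Finset.prod_ne_zero_iff.2 fun b _ => pow_ne_zero _ (hne b)
    rw [← hφ, binomial, map_sub, sub_eq_zero, ← h1, mul_eq_right₀ h2]
  refine ⟨{ carrier := {u | χ u = 1}, add_mem' := ?_, zero_mem' := hzero, neg_mem' := ?_ }, hbin⟩
  · intro u v hu hv
    rw [Set.mem_ofPred_eq] at hu hv ⊢
    rw [hadd, hu, hv, one_mul]
  · intro u hu
    rw [Set.mem_ofPred_eq] at hu ⊢
    have := hadd u (-u)
    rwa [add_neg_cancel, hzero, hu, one_mul, eq_comm] at this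

/-- If `B` contains a basis of the lattice, then `J_B` is a prime ideal of codimension `m`. -/
theorem height_latticeIdeal {β e : Fin m → Fin m → ℤ} (hβ : ∀ i, β i ∈ B)
    (he : ∀ i j, e i ⬝ᵥ β j = if i = j then 1 else 0) : (latticeIdeal k B).height = m := by
  classical
  have hsum : ∀ u : Fin m → ℤ, ∑ i, (u ⬝ᵥ β i) • e i = u := by
    intro u
    have h1 : (Matrix.of e) * (Matrix.of β).transpose = 1 := by
      ext i j
      rw [Matrix.mul_apply', Matrix.one_apply]
      exact he i j
    have h2 := mul_eq_one_comm.1 h1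
    have h3 : Matrix.vecMul u ((Matrix.of β).transpose * Matrix.of e) = u := by
      rw [h2, Matrix.vecMul_one]
    rw [← Matrix.vecMul_vecMul] at h3
    conv_rhs => rw [← h3]
    ext j
    simp [Matrix.vecMul, dotProduct, Finset.sum_apply, Matrix.of_apply, Matrix.transpose_apply]
  let b' : Fin m → B := fun i => ⟨β i, hβ i⟩
  let ρ : Fin m → (B → ℤ) →+ (B → ℤ) := fun i => AddMonoidHom.mk'
    (fun z => z - z (b' i) • pairing B (e i)) (fun x y => by
      rw [Pi.add_apply, add_smul]; abel)
  -- `π s` projects along the vectors `pairing B (e i)`, `i ∈ s`; the coefficient of each is read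
  -- off at the coordinate `b' i`.
  let π : Finset (Fin m) → (B → ℤ) →+ (B → ℤ) := fun s => AddMonoidHom.mk'
    (fun z => z - ∑ i ∈ s, z (b' i) • pairing B (e i)) (fun x y => by
      simp_rw [Pi.add_apply, add_smul, Finset.sum_add_distrib]; abel)
  have hπ : ∀ s z, π s z = z - ∑ i ∈ s, z (b' i) • pairing B (e i) := fun _ _ => rfl
  have hpe : ∀ i j, pairing B (e i) (b' j) = if i = j then 1 else 0 := fun i j => he i j
  have hπe : ∀ s i, π s (pairing B (e i)) = if i ∈ s then 0 else pairing B (e i) := by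
    intro s i
    rw [hπ]
    simp_rw [hpe, ite_smul, zero_smul, one_smul, Finset.sum_ite_eq]
    split_ifs <;> simp
  have hπi : ∀ s i, i ∉ s → π (insert i s) = (ρ i).comp (π s) := by
    intro s i hi
    refine AddMonoidHom.ext fun z => ?_
    have h1 : π s z (b' i) = z (b' i) := by
      rw [hπ]
      simp only [Pi.sub_apply, Finset.sum_apply, Pi.smul_apply, hpe, smul_eq_mul, mul_ite, mul_one,
        mul_zero, Finset.sum_ite_eq', if_neg hi, sub_zero]
    show _ = π s z - π s z (b' i) • pairing B (e i)
    rw [h1, hπ, hπ, Finset.sum_insert hi]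
    abel
  -- The kernels are prime, as the group algebra is a domain. Enlarging `s` by `i` adds the binomial
  -- of `e i`, so they form a strict chain.
  have hlow : ∀ s : Finset (Fin m), (s.card : ℕ∞) ≤ (RingHom.ker (toricMap k (π s))).height := by
    intro s
    induction s using Finset.induction_on with
    | empty => simp
    | insert i s hi ih =>
      have hlt : RingHom.ker (toricMap k (π s)) < RingHom.ker (toricMap k (π (insert i s))) := by
        refine lt_of_le_of_ne ?_ fun h => ?_
        · rw [hπi s i hi]
          exact ker_toricMap_le_ker_comp _ _
        · have h1 : binomial k B (e i) ∈ RingHom.ker (toricMap k (π (insert i s))) := by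
            rw [RingHom.mem_ker, toricMap_binomial, hπe, if_pos (Finset.mem_insert_self i s)]
          rw [← h, RingHom.mem_ker, toricMap_binomial, hπe, if_neg hi] at h1
          have := congrFun h1 (b' i)
          rw [hpe, if_pos rfl] at this
          exact one_ne_zero this
      have hp1 : (RingHom.ker (toricMap k (π s))).IsPrime := RingHom.ker_isPrime _
      have hp2 : (RingHom.ker (toricMap k (π (insert i s)))).IsPrime := RingHom.ker_isPrime _
      rw [Finset.card_insert_of_notMem hi]
      push_cast
      exact (add_le_add_left ih 1).trans (Ideal.height_add_one_le_of_lt_of_isPrime hlt)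
  have hπu : ∀ z, π Finset.univ z = z - pairing B (∑ i, z (b' i) • e i) := by
    intro z
    rw [hπ, map_sum]
    simp_rw [map_zsmul]
  have hker : latticeIdeal k B = RingHom.ker (toricMap k (π Finset.univ)) := by
    apply le_antisymm
    · rw [latticeIdeal, Ideal.span_le]
      rintro _ ⟨u, rfl⟩
      show toricMap k (π Finset.univ) (binomial k B u) = 0
      rw [toricMap_binomial, hπu]
      have : ∑ i, pairing B u (b' i) • e i = u := hsum u
      rw [this, sub_self]
    · refine ker_toricMap_le _ _ fun d d' hdd => ?_
      rw [← sub_eq_zero, ← map_sub, hπu, sub_eq_zero] at hdd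
      exact monomial_sub_mem_latticeIdeal fun b => congrFun hdd b
  have hprime : (latticeIdeal k B).IsPrime := hker ▸ RingHom.ker_isPrime _
  apply le_antisymm
  · have hX : ∀ b, MvPolynomial.X b ∉ latticeIdeal k B := by
      intro b
      rw [hker, RingHom.mem_ker, MvPolynomial.X, toricMap_monomial]
      simp
    -- For the upper bound by Krull's height theorem: a prime inside `J_B` that contains the
    -- binomials of all `e i` contains no variable, so its binomials form a group, which contains
    -- the generators `e i` of `ℤ^m`.
    have hmin : latticeIdeal k B ∈
        (Ideal.span (Finset.univ.image fun i => binomial k B (e i) : Finset _)).minimalPrimes := by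
      refine ⟨⟨hprime, ?_⟩, ?_⟩
      · rw [Ideal.span_le]
        intro f hf
        obtain ⟨i, -, rfl⟩ := Finset.mem_image.1 (Finset.mem_coe.1 hf)
        exact Ideal.subset_span (Set.mem_range_self _)
      · rintro q ⟨hq, hsq⟩ hqJ
        obtain ⟨L, hL⟩ := exists_addSubgroup_binomial_mem q fun b hb => hX b (hqJ hb)
        rw [latticeIdeal, Ideal.span_le]
        rintro _ ⟨u, rfl⟩
        rw [SetLike.mem_coe, ← hL, ← hsum u]
        refine sum_mem fun i _ => zsmul_mem ((hL _).2 (hsq (Ideal.subset_span ?_))) _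
        simp
    refine (Ideal.height_le_card_of_mem_minimalPrimes_span_finset hmin).trans ?_
    have := Finset.card_image_le (s := Finset.univ) (f := fun i => binomial k B (e i))
    rw [Finset.card_univ, Fintype.card_fin] at this
    exact_mod_cast this
  · rw [hker]
    simpa using hlow Finset.univ

end Height

/-- The lifted vertices of an empty triangle form a lattice basis; the integral barycentric
coordinates are the dual basis. -/
theorem height_latticeIdeal_image_lift {k : Type*} [Field k] {A : Finset (Fin 2 → ℤ)}
    {AR : Finset (Fin 2 → ℝ)} (hAR : (AR : Set (Fin 2 → ℝ)) = toReal '' (A : Set (Fin 2 → ℤ)))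
    (hA : ∀ z, toReal z ∈ convexHull ℝ (AR : Set (Fin 2 → ℝ)) → z ∈ A) {x : Fin 2 → ℝ}
    (h : Generic AR x) (hx : x ∈ convexHull ℝ (AR : Set (Fin 2 → ℝ))) :
    (latticeIdeal k (A.image lift)).height = 3 := by
  obtain ⟨p, hpA, -, hp⟩ := h.exists_empty_basis hx fun z hz => by
    rw [← Finset.mem_coe, hAR]
    exact Set.mem_image_of_mem _ (hA z hz)
  have hpA' : ∀ i, ∃ a ∈ A, toReal a = p i := fun i => by
    have := hpA i
    rw [← Finset.mem_coe, hAR] at this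
    exact this
  choose q hqA hq using hpA'
  choose e he using fun i => exists_int_dotLift (p.coord i)
    fun z => exists_int_coord_of_empty p (fun j => ⟨_, hq j⟩) hp z i
  refine height_latticeIdeal (β := fun i => lift (q i)) (e := e)
    (fun i => Finset.mem_image_of_mem _ (hqA i)) fun i j => ?_
  have := he i (toReal (q j))
  rw [toReal_dotProduct_lift, hq, AffineBasis.coord_apply] at this
  exact_mod_cast this.symm

end Supernormal

theorem proposition5p3 (k : Type*) [Field k] (P : Set (Fin 2 → ℝ))
    (hP : Supernormal.IsLatticePolygon P) :
    Supernormal.mu P ≤ Supernormal.phi k 3 := by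
  classical
  obtain ⟨A, hA, hPA⟩ := hP.exists_points
  refine iSup₂_le fun R hR => ?_
  subst hPA
  obtain ⟨r, hr⟩ := hR.1
  obtain ⟨hcone, hcl⟩ := hR.closure_groebnerCell (k := k) (fun z hz => (hA z).2 hz) hr
  have hAR : ((A.image Supernormal.toReal : Finset _) : Set (Fin 2 → ℝ)) =
      Supernormal.toReal '' (A : Set (Fin 2 → ℤ)) := by simp
  have hrgen : Supernormal.Generic (A.image Supernormal.toReal) r :=
    hR.generic (by rw [hAR]) (fun a ha => by
      obtain ⟨z, -, rfl⟩ := Finset.mem_image.1 ha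
      exact ⟨z, rfl⟩) hr
  have hheight := Supernormal.height_latticeIdeal_image_lift (k := k) hAR
    (fun z hz => (hA z).2 (hAR ▸ hz)) hrgen (by rw [hAR]; exact hR.subset (interior_subset hr))
  calc (Supernormal.facets R).encard ≤ (Supernormal.facets (Supernormal.coneOver R)).encard :=
        Supernormal.encard_facets_le_coneOver
    _ ≤ Supernormal.phi k 3 :=
        le_iSup₂_of_le _ hheight (le_iSup₂_of_le _ ⟨_, hcone, hcl.symm⟩ le_rfl)
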